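/- **Setting.** Let $q\in\mathbb C^*$ not be a root of unity, fix a square root $q^{1/2}$, and write $b(x)=x-x^{-1}$, $[X,Y]_q=qXY-q^{-1}YX$, $[n]_q=\frac{q^n-q^{-n}}{q-q^{-1}}$. Let $2s\ge 0$ be an integer and let $\mathsf b,\mathsf c,\mathsf b^*,\mathsf c^*,\zeta,\chi\in\mathbb C^*$ with $\mathsf b\mathsf c=\mathsf b^*\mathsf c^*$. Put $\theta_M=\mathsf bq^{2M}+\mathsf cq^{-2M}$, $\theta^*_N=\mathsf b^*q^{2N}+\mathsf c^*q^{-2N}$, $X=\mathsf bq^{2s}+\mathsf cq^{-2s}$, $X^*=\mathsf b^*q^{2s}+\mathsf c^*q^{-2s}$, $Z=\zeta^2+\zeta^{-2}$, $h_0=q^{2s+1}+q^{-2s-1}$, and $$\rho=-\mathsf b\mathsf c(q^2-q^{-2})^2,\qquad \omega=(q-q^{-1})^2(\mathsf b\mathsf cZh_0-XX^*),$$ $$\eta=-\tfrac{(q^2-q^{-2})^2}{q+q^{-1}}\mathsf b\mathsf c\,(XZ-X^*h_0),\qquad \eta^*=-\tfrac{(q^2-q^{-2})^2}{q+q^{-1}}\mathsf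 b^*\mathsf c^*(X^*Z-Xh_0).$$ The Askey–Wilson algebra $\mathrm{AW}$ is the unital $\mathbb C$-algebra generated by $\mathsf A,\mathsf A^*$ with relations $$[\mathsf A,[\mathsf A,\mathsf A^*]_q]_{q^{-1}}=\rho\mathsf A^*+\omega\mathsf A+\eta,\qquad [\mathsf A^*,[\mathsf A^*,\mathsf A]_q]_{q^{-1}}=\rho\mathsf A+\omega\mathsf A^*+\eta^*.$$ Let $\pi:\mathrm{AW}\to\mathrm{End}(\mathcal V)$ be an irreducible representation, $\dim\mathcal V=2s+1$, such that $\pi(\mathsf A)$, $\pi(\mathsf A^*)$ are diagonalizable and multiplicity-free with eigenvalues $\theta_0,\dots,\theta_{2s}$ and $\theta_0^*,\dots,\theta_{2s}^*$ respectively. Let $|\theta_M\rangle$, $|\theta^*_N\rangle$ be (arbitrarily normalized) eigenbases of $\mathcal V$ and $\langle\theta_M|$, $\langle\theta_N^*|$ dual eigenbases of the dual space, i.e. $\langle\theta_M|\pi(\mathsf A)=\theta_M\langle\theta_M|$, $\langle\theta^*_N|\pi(\mathsf A^*)=\theta^*_N\langle\theta^*_N|$. Put $\xi_M=\langle\theta_M|\theta_M\rangle$,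 $\xi^*_N=\langle\theta^*_N|\theta^*_N\rangle$, let $P$ be defined by $|\theta^*_N\rangle=\sum_MP_{MN}|\theta_M\rangle$, and let $\tilde A^*_{M,M'}$, $\tilde A_{N,N'}$ be defined by $\langle\theta_M|\pi(\mathsf A^*)=\sum_{M'}\tilde A^*_{M,M'}\langle\theta_{M'}|$ and $\langle\theta^*_N|\pi(\mathsf A)=\sum_{N'}\tilde A_{N,N'}\langle\theta^*_{N'}|$. **Dual Bethe states.** Let $\bar\eta(u)=(q+q^{-1})\rho^{-1}(\eta u+\eta^*u^{-1})$ and $$\mathcal A(u)=b(u^2)(qu\mathsf A-q^{-1}u^{-1}\mathsf A^*)-\bar\eta(u),\qquad \mathcal D(u)=b(u^2)(qu\mathsf A^*-q^{-1}u^{-1}\mathsf A)-\bar\eta(u^{-1}),$$ $$\mathcal B(u)=\chi\, b(u^2)\Big(\rho^{-1}\big([\mathsf A^*,\mathsf A]_q+\tfrac{\omega}{q-q^{-1}}\big)+\tfrac{qu^2+q^{-1}u^{-2}}{q^2-q^{-2}}\Big),$$ $$\mathcal C(u)=\rho\chi^{-1} b(u^2)\Big(\rho^{-1}\big([\mathsf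 A,\mathsf A^*]_q+\tfrac{\omega}{q-q^{-1}}\big)+\tfrac{qu^2+q^{-1}u^{-2}}{q^2-q^{-2}}\Big).$$ For $\epsilon=\pm1$, $\alpha,\beta\in\mathbb C$, $m\in\mathbb Z$ let $\gamma^\epsilon(u,m)=\alpha^{\frac{1-\epsilon}2}\beta^{\frac{1+\epsilon}2}q^{-m}u-\alpha^{\frac{1+\epsilon}2}\beta^{\frac{1-\epsilon}2}q^mu^{-1}$ and $$\mathscr C^\epsilon(u,m)=\frac{\epsilon\, q^{-\epsilon}u^{-\epsilon}}{\gamma^\epsilon(1,m-1)}\Big(\mathcal B(u)+\alpha q^{\epsilon m}\big(u^{-\epsilon}\mathcal A(u)-u^{\epsilon}\mathcal D(u)\big)-\alpha^2q^{2\epsilon m}\,\mathcal C(u)\Big).$$ Let $m_0\in\mathbb Z$. For $\bar v=(v_1,\dots,v_{2s})$ put $$\langle\Psi_+^{2s}(\bar v,m_0)|=\langle\theta_0^*|\,\pi\big(\mathscr C^+(v_1,m_0+2)\cdots\mathscr C^+(v_{2s},m_0+4s)\big),\quad \alpha=0,\ (q^2-q^{-2})\chi^{-1}\beta\,\mathsf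 b^*q^{-m_0+2}=1,$$ $$\langle\Psi_-^{2s}(\bar v,m_0)|=\langle\theta_0|\,\pi\big(\mathscr C^-(v_1,m_0+2)\cdots\mathscr C^-(v_{2s},m_0+4s)\big),\quad \alpha=0,\ (q^2-q^{-2})\chi^{-1}\beta\,\mathsf c\,q^{m_0-2}=-1.$$ **Dual inhomogeneous Bethe equations.** Let $f(u,v)=\frac{b(qv/u)b(uv)}{b(v/u)b(quv)}$, $h(u,v)=\frac{b(q^2uv)b(qu/v)}{b(quv)b(u/v)}$, $$\Lambda_1^\epsilon(u)=\tfrac{q^{-2s-1}}{u^\epsilon}(q^{2s+1}u\zeta^{-1}-u^{-1}\zeta)(q^{2s+1}u\zeta-u^{-1}\zeta^{-1})(u\mathsf c^*q^{-2s}+u^{-1}\mathsf bq^{2s})\Big(u\big(\tfrac{\mathsf c}{\mathsf c^*}\big)^{\frac{1-\epsilon}2}+u^{-1}\big(\tfrac{\mathsf b^*}{\mathsf b}\big)^{\frac{1+\epsilon}2}\Big),$$ $$\begin{aligned}\Lambda_2^\epsilon(u)={}&\tfrac{(u^2-u^{-2})q^{-2s-1}}{u^\epsilon(qu^2-q^{-1}u^{-2})}(q^{2s-1}u^{-1}\zeta-u\zeta^{-1})(q^{2s-1}u^{-1}\zeta^{-1}-u\zeta)\\&\times(q^2u\mathsf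 bq^{2s}+u^{-1}\mathsf c^*q^{-2s})\Big(q^2u\big(\tfrac{\mathsf b^*}{\mathsf b}\big)^{\frac{1+\epsilon}2}+u^{-1}\big(\tfrac{\mathsf c}{\mathsf c^*}\big)^{\frac{1-\epsilon}2}\Big),\end{aligned}$$ $\tilde\nu_+=q^{1+4s}\mathsf b^*$, $\tilde\nu_-=q^{-1-4s}\mathsf c$, and, for $\bar y=(y_1,\dots,y_{2s})$ and $1\le i\le 2s$, $$\begin{aligned}\tilde E_\pm(y_i,\bar y_i)={}&\frac{b(y_i^2)}{b(qy_i^2)}y_i^{\mp1}\prod_{j\ne i}f(y_i,y_j)\,\Lambda_1^{\pm}(y_i)-(q^2y_i^3)^{\pm1}\prod_{j\ne i}h(y_i,y_j)\,\Lambda_2^\pm(y_i)\\&+\tilde\nu_\pm\frac{b(y_i^2)}{b(q)}\,\frac{\prod_{k=0}^{2s}b(q^{1/2+k-s}\zeta y_i)\,b(q^{1/2+k-s}\zeta^{-1}y_i)}{\prod_{j\ne i}b(y_iy_j^{-1})\,b(qy_iy_j)}.\end{aligned}$$ Call $\bar y$ *nontrivial and admissible* if $y_i\ne0$, $y_i^2\ne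 y_i^{-2}$ and $b(qy_i^2)\neq0$ for all $i$, and the numbers $\frac{qy_i^2+q^{-1}y_i^{-2}}{q+q^{-1}}$ are pairwise distinct (so that all denominators above are nonzero). For $0\le M,N\le 2s$ write $\bar y\in dS_+^{M(i)}$ if $\bar y$ is nontrivial and admissible, $\tilde E_+(y_j,\bar y_j)=0$ for all $j$, and $$\theta_M=q^{4s}\Big(\mathsf b^*Z[2s]_q+q^{-2s}X-q^{-1}\mathsf b^*\sum_{j=1}^{2s}(qy_j^2+q^{-1}y_j^{-2})\Big);$$ write $\bar y\in dS_-^{*N(i)}$ if $\bar y$ is nontrivial and admissible, $\tilde E_-(y_j,\bar y_j)=0$ for all $j$, and $$\theta^*_N=q^{-4s}\Big(\mathsf cZ[2s]_q+q^{2s}X^*-q\,\mathsf c\sum_{j=1}^{2s}(qy_j^2+q^{-1}y_j^{-2})\Big).$$ **Lemma.** (i) For every $0\le M\le 2s$ and every $\bar v'\in dS_+^{M(i)}$, $$\langle\theta_M|=\tilde{\mathcal N}^*_{2s}(\bar v')\,P_{M,2s}\,\frac{\xi_M}{\xi^*_{2s}}\;\langle\Psi_+^{2s}(\bar v',m_0)|,\qquad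 \tilde{\mathcal N}^*_{2s}(\bar y)=\prod_{k=1}^{2s}\big(-q\,y_k^{-1}b(y_k^2)\tilde A_{k-1,k}\big)^{-1}.$$ (ii) For every $0\le N\le 2s$ and every $\bar y'\in dS_-^{*N(i)}$, $$\langle\theta^*_N|=\tilde{\mathcal N}_{2s}(\bar y')\,(P^{-1})_{N,2s}\,\frac{\xi^*_N}{\xi_{2s}}\;\langle\Psi_-^{2s}(\bar y',m_0)|,\qquad \tilde{\mathcal N}_{2s}(\bar v)=\prod_{k=1}^{2s}\big(q^{-1}v_k\,b(v_k^2)\tilde A^*_{k-1,k}\big)^{-1}.$$ (iii) In particular, under the hypothesis that $dS_+^{M(i)}$ and $dS_-^{*N(i)}$ are nonempty for all $0\le M,N\le2s$, every dual eigenvector $\langle\theta_M|$ (resp. $\langle\theta_N^*|$) is such a multiple of a dual inhomogeneous Bethe state $\langle\Psi_+^{2s}|$ (resp. $\langle\Psi_-^{2s}|$). -/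

import Mathlib

noncomputable section

namespace QRacahBethe

/-- `b(x) = x - x⁻¹`. -/
def b (x : ℂ) : ℂ := x - x⁻¹

/-- The `q`-commutator `[X, Y]_q = q X Y - q⁻¹ Y X`. -/
def qComm {R : Type*} [Ring R] [Algebra ℂ R] (q : ℂ) (X Y : R) : R :=
  q • (X * Y) - q⁻¹ • (Y * X)

/-- The scalar parameters: `d` is `2s`, `r` is a square root of `q`, `tb, tc, tbs, tcs` are the
coefficients of the two eigenvalue sequences, `ζ` parametrizes the remaining structure constants,
and `χ` is the free nonzero scalar in the off-diagonal entries of the reflection matrix. -/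
structure Params where
  d : ℕ
  q : ℂ
  r : ℂ
  tb : ℂ
  tc : ℂ
  tbs : ℂ
  tcs : ℂ
  ζ : ℂ
  χ : ℂ
  q_ne_zero : q ≠ 0
  q_not_root_of_unity : ∀ n : ℕ, 0 < n → q ^ n ≠ 1
  r_sq : r ^ 2 = q
  tb_ne_zero : tb ≠ 0
  tc_ne_zero : tc ≠ 0
  tbs_ne_zero : tbs ≠ 0
  tcs_ne_zero : tcs ≠ 0
  ζ_ne_zero : ζ ≠ 0
  χ_ne_zero : χ ≠ 0
  tb_mul_tc : tb * tc = tbs * tcs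

/-- The two generators of the Askey-Wilson algebra. -/
inductive AWGen where
  | A : AWGen
  | Astar : AWGen

/-- The Askey-Wilson relations. -/
inductive AWRel (q ρ ω η ηs : ℂ) : FreeAlgebra ℂ AWGen → FreeAlgebra ℂ AWGen → Prop
  | aw1 : AWRel q ρ ω η ηs
      (qComm q⁻¹ (FreeAlgebra.ι ℂ AWGen.A)
        (qComm q (FreeAlgebra.ι ℂ AWGen.A) (FreeAlgebra.ι ℂ AWGen.Astar)))
      (ρ • FreeAlgebra.ι ℂ AWGen.Astar + ω • FreeAlgebra.ι ℂ AWGen.A + η • 1)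
  | aw2 : AWRel q ρ ω η ηs
      (qComm q⁻¹ (FreeAlgebra.ι ℂ AWGen.Astar)
        (qComm q (FreeAlgebra.ι ℂ AWGen.Astar) (FreeAlgebra.ι ℂ AWGen.A)))
      (ρ • FreeAlgebra.ι ℂ AWGen.A + ω • FreeAlgebra.ι ℂ AWGen.Astar + ηs • 1)

namespace Params

variable (D : Params)

/-- `θ_M = 𝖻 q^{2M} + 𝖼 q^{-2M}`. -/
def θ (M : ℕ) : ℂ := D.tb * D.q ^ (2 * (M : ℤ)) + D.tc * D.q ^ (-2 * (M : ℤ))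

/-- `θ*_N = 𝖻* q^{2N} + 𝖼* q^{-2N}`. -/
def θs (N : ℕ) : ℂ := D.tbs * D.q ^ (2 * (N : ℤ)) + D.tcs * D.q ^ (-2 * (N : ℤ))

/-- `ζ² + ζ⁻²`. -/
def Z : ℂ := D.ζ ^ 2 + (D.ζ ^ 2)⁻¹

/-- `𝖻 q^{2s} + 𝖼 q^{-2s}`. -/
def X : ℂ := D.tb * D.q ^ (D.d : ℤ) + D.tc * D.q ^ (-(D.d : ℤ))

/-- `𝖻* q^{2s} + 𝖼* q^{-2s}`. -/
def Xs : ℂ := D.tbs * D.q ^ (D.d : ℤ) + D.tcs * D.q ^ (-(D.d : ℤ))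

/-- `q^{2s+1} + q^{-2s-1}`. -/
def h0 : ℂ := D.q ^ ((D.d : ℤ) + 1) + D.q ^ (-(D.d : ℤ) - 1)

/-- The structure constants `ρ, ω, η, η*`. -/
def ρ : ℂ := -(D.tb * D.tc) * (D.q ^ 2 - (D.q ^ 2)⁻¹) ^ 2

def ω : ℂ := (D.q - D.q⁻¹) ^ 2 * (D.tb * D.tc * D.Z * D.h0 - D.X * D.Xs)

def η : ℂ :=
  -((D.q ^ 2 - (D.q ^ 2)⁻¹) ^ 2 / (D.q + D.q⁻¹)) * (D.tb * D.tc) * (D.X * D.Z - D.Xs * D.h0)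

def ηs : ℂ :=
  -((D.q ^ 2 - (D.q ^ 2)⁻¹) ^ 2 / (D.q + D.q⁻¹)) * (D.tbs * D.tcs) * (D.Xs * D.Z - D.X * D.h0)

/-- The Askey-Wilson algebra with the structure constants above. -/
abbrev AW : Type := RingQuot (AWRel D.q D.ρ D.ω D.η D.ηs)

def genA : D.AW := RingQuot.mkAlgHom ℂ (AWRel D.q D.ρ D.ω D.η D.ηs) (FreeAlgebra.ι ℂ AWGen.A)

def genAs : D.AW :=
  RingQuot.mkAlgHom ℂ (AWRel D.q D.ρ D.ω D.η D.ηs) (FreeAlgebra.ι ℂ AWGen.Astar)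

/-! ### Reflection matrix and dynamical operators -/

/-- `η̄(u) = (q + q⁻¹) ρ⁻¹ (η u + η* u⁻¹)`. -/
def ηbar (u : ℂ) : ℂ := (D.q + D.q⁻¹) * D.ρ⁻¹ * (D.η * u + D.ηs * u⁻¹)

/-- The four entries of the reflection matrix `K(u)`, a solution of the reflection equation. -/
def KA (u : ℂ) : D.AW :=
  b (u ^ 2) • ((D.q * u) • D.genA - (D.q⁻¹ * u⁻¹) • D.genAs) - D.ηbar u • 1

def KD (u : ℂ) : D.AW :=
  b (u ^ 2) • ((D.q * u) • D.genAs - (D.q⁻¹ * u⁻¹) • D.genA) - D.ηbar u⁻¹ • 1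

def KB (u : ℂ) : D.AW :=
  (D.χ * b (u ^ 2)) • (D.ρ⁻¹ • (qComm D.q D.genAs D.genA + (D.ω / (D.q - D.q⁻¹)) • 1)
    + ((D.q * u ^ 2 + D.q⁻¹ * (u ^ 2)⁻¹) / (D.q ^ 2 - (D.q ^ 2)⁻¹)) • 1)

def KC (u : ℂ) : D.AW :=
  (D.ρ * D.χ⁻¹ * b (u ^ 2)) • (D.ρ⁻¹ • (qComm D.q D.genA D.genAs + (D.ω / (D.q - D.q⁻¹)) • 1)
    + ((D.q * u ^ 2 + D.q⁻¹ * (u ^ 2)⁻¹) / (D.q ^ 2 - (D.q ^ 2)⁻¹)) • 1)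

/-- `γ^ε(u, m)`, for `ε = ±1`. -/
def γ (ε : ℤ) (α β u : ℂ) (m : ℤ) : ℂ :=
  α ^ ((1 - ε) / 2) * β ^ ((1 + ε) / 2) * D.q ^ (-m) * u
    - α ^ ((1 + ε) / 2) * β ^ ((1 - ε) / 2) * D.q ^ m * u⁻¹

/-- The dynamical operator `𝒞^ε(u, m)`, for `ε = ±1`. -/
def dynC (ε : ℤ) (α β u : ℂ) (m : ℤ) : D.AW :=
  ((ε : ℂ) * D.q ^ (-ε) * u ^ (-ε) / D.γ ε α β 1 (m - 1)) •
    (D.KB u + (α * D.q ^ (ε * m)) • (u ^ (-ε) • D.KA u - u ^ ε • D.KD u)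
      - (α * D.q ^ (ε * m)) ^ 2 • D.KC u)

/-- The string `C^ε(v̄, m, N) = 𝒞^ε(v₁, m + 2) ⋯ 𝒞^ε(v_N, m + 2N)`. -/
def stringC (ε : ℤ) (α β : ℂ) {N : ℕ} (v : Fin N → ℂ) (m : ℤ) : D.AW :=
  (List.ofFn fun i : Fin N => D.dynC ε α β (v i) (m + 2 * ((i : ℤ) + 1))).prod

/-! ### Dual inhomogeneous Bethe equations -/

def f (u v : ℂ) : ℂ := b (D.q * v / u) * b (u * v) / (b (v / u) * b (D.q * u * v))

def h (u v : ℂ) : ℂ := b (D.q ^ 2 * u * v) * b (D.q * u / v) / (b (D.q * u * v) * b (u / v))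

/-- `Λ₁^ε(u)`, for `ε = ±1`. -/
def Λ₁ (ε : ℤ) (u : ℂ) : ℂ :=
  D.q ^ (-(D.d : ℤ) - 1) / u ^ ε
    * (D.q ^ ((D.d : ℤ) + 1) * u * D.ζ⁻¹ - u⁻¹ * D.ζ)
    * (D.q ^ ((D.d : ℤ) + 1) * u * D.ζ - u⁻¹ * D.ζ⁻¹)
    * (u * D.tcs * D.q ^ (-(D.d : ℤ)) + u⁻¹ * D.tb * D.q ^ (D.d : ℤ))
    * (u * (D.tc / D.tcs) ^ ((1 - ε) / 2) + u⁻¹ * (D.tbs / D.tb) ^ ((1 + ε) / 2))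

/-- `Λ₂^ε(u)`, for `ε = ±1`. -/
def Λ₂ (ε : ℤ) (u : ℂ) : ℂ :=
  (u ^ 2 - (u ^ 2)⁻¹) * D.q ^ (-(D.d : ℤ) - 1)
      / (u ^ ε * (D.q * u ^ 2 - D.q⁻¹ * (u ^ 2)⁻¹))
    * (D.q ^ ((D.d : ℤ) - 1) * u⁻¹ * D.ζ - u * D.ζ⁻¹)
    * (D.q ^ ((D.d : ℤ) - 1) * u⁻¹ * D.ζ⁻¹ - u * D.ζ)
    * (D.q ^ 2 * u * D.tb * D.q ^ (D.d : ℤ) + u⁻¹ * D.tcs * D.q ^ (-(D.d : ℤ)))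
    * (D.q ^ 2 * u * (D.tbs / D.tb) ^ ((1 + ε) / 2) + u⁻¹ * (D.tc / D.tcs) ^ ((1 - ε) / 2))

/-- `ν̃₊ = q^{1+4s} 𝖻*` and `ν̃₋ = q^{-1-4s} 𝖼`. -/
def νtilde (ε : ℤ) : ℂ :=
  if ε = 1 then D.q ^ (1 + 2 * (D.d : ℤ)) * D.tbs else D.q ^ (-1 - 2 * (D.d : ℤ)) * D.tc

/-- The left-hand side `Ẽ_ε(y_i, ȳ_i)` of the dual inhomogeneous Bethe equations, for `ε = ±1`.
The exponent `1 + 2k - d` of `r = q^{1/2}` is twice `1/2 + k - s`. -/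
def Etilde (ε : ℤ) (y : Fin D.d → ℂ) (i : Fin D.d) : ℂ :=
  b (y i ^ 2) / b (D.q * y i ^ 2) * y i ^ (-ε)
      * (∏ j ∈ Finset.univ.erase i, D.f (y i) (y j)) * D.Λ₁ ε (y i)
    - (D.q ^ 2 * y i ^ 3) ^ ε
      * (∏ j ∈ Finset.univ.erase i, D.h (y i) (y j)) * D.Λ₂ ε (y i)
    + D.νtilde ε * (b (y i ^ 2) / b D.q)
      * ((∏ k ∈ Finset.range (D.d + 1),
            b (D.r ^ (1 + 2 * (k : ℤ) - D.d) * D.ζ * y i)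
              * b (D.r ^ (1 + 2 * (k : ℤ) - D.d) * D.ζ⁻¹ * y i))
          / ∏ j ∈ Finset.univ.erase i, b (y i * (y j)⁻¹) * b (D.q * y i * y j))

/-- The symmetrized Bethe root `U = (q u² + q⁻¹ u⁻²)/(q + q⁻¹)`. -/
def symRoot (u : ℂ) : ℂ := (D.q * u ^ 2 + D.q⁻¹ * (u ^ 2)⁻¹) / (D.q + D.q⁻¹)

/-- Nontrivial admissible roots at which the Bethe equations are defined: `y_i ≠ 0`,
`y_i² ≠ y_i⁻²`, the denominators `b(q y_i²)` do not vanish, and the symmetrized roots are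
pairwise distinct (so that the remaining denominators do not vanish either). -/
def NontrivialAdmissible (y : Fin D.d → ℂ) : Prop :=
  (∀ i, y i ≠ 0 ∧ y i ^ 2 ≠ (y i ^ 2)⁻¹ ∧ b (D.q * y i ^ 2) ≠ 0) ∧
    ∀ i j, i ≠ j → D.symRoot (y i) ≠ D.symRoot (y j)

/-- `[2s]_q`. -/
def brd : ℂ := (D.q ^ (D.d : ℤ) - D.q ^ (-(D.d : ℤ))) / (D.q - D.q⁻¹)

/-- The value attached to a set of roots of `Ẽ₊ = 0`, to be compared with `θ_M`. -/
def dualEigPlus (y : Fin D.d → ℂ) : ℂ :=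
  D.q ^ (2 * (D.d : ℤ)) * (D.tbs * D.Z * D.brd + D.q ^ (-(D.d : ℤ)) * D.X
    - D.q⁻¹ * D.tbs * ∑ j, (D.q * y j ^ 2 + D.q⁻¹ * (y j ^ 2)⁻¹))

/-- The value attached to a set of roots of `Ẽ₋ = 0`, to be compared with `θ*_N`. -/
def dualEigMinus (v : Fin D.d → ℂ) : ℂ :=
  D.q ^ (-2 * (D.d : ℤ)) * (D.tc * D.Z * D.brd + D.q ^ (D.d : ℤ) * D.Xs
    - D.q * D.tc * ∑ j, (D.q * v j ^ 2 + D.q⁻¹ * (v j ^ 2)⁻¹))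

/-- `y` is a set of roots `dS₊^{M(i)}`. -/
def IsDualRootsPlus (M : Fin (D.d + 1)) (y : Fin D.d → ℂ) : Prop :=
  D.NontrivialAdmissible y ∧ (∀ j, D.Etilde 1 y j = 0) ∧ D.θ M = D.dualEigPlus y

/-- `v` is a set of roots `dS₋^{*N(i)}`. -/
def IsDualRootsMinus (N : Fin (D.d + 1)) (v : Fin D.d → ℂ) : Prop :=
  D.NontrivialAdmissible v ∧ (∀ j, D.Etilde (-1) v j = 0) ∧ D.θs N = D.dualEigMinus v

/-- The existence hypothesis for the roots of the dual inhomogeneous Bethe equations. -/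
def DualRootsExist : Prop :=
  (∀ M, ∃ y, D.IsDualRootsPlus M y) ∧ ∀ N, ∃ v, D.IsDualRootsMinus N v

end Params

/-! ### Irreducible representations with eigenbases and dual eigenbases -/

/-- An irreducible representation `π` of the Askey-Wilson algebra on `V`, of dimension `d + 1`, on
which both generators are diagonalizable and multiplicity-free with spectra `θ_M` and `θ*_N`,
together with arbitrarily normalized eigenbases and dual eigenbases. -/
structure LeonardRep (D : Params) (V : Type*) [AddCommGroup V] [Module ℂ V] where
  π : D.AW →ₐ[ℂ] Module.End ℂ V
  irreducible : ∀ W : Submodule ℂ V, (∀ x : D.AW, ∀ w ∈ W, π x w ∈ W) → W = ⊥ ∨ W = ⊤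
  θ_injective : Function.Injective fun M : Fin (D.d + 1) => D.θ M
  θs_injective : Function.Injective fun N : Fin (D.d + 1) => D.θs N
  ket : Module.Basis (Fin (D.d + 1)) ℂ V
  ket_eigen : ∀ M, π D.genA (ket M) = D.θ M • ket M
  kets : Module.Basis (Fin (D.d + 1)) ℂ V
  kets_eigen : ∀ N, π D.genAs (kets N) = D.θs N • kets N
  bra : Module.Basis (Fin (D.d + 1)) ℂ (Module.Dual ℂ V)
  bra_eigen : ∀ M, (bra M).comp (π D.genA) = D.θ M • bra M
  bras : Module.Basis (Fin (D.d + 1)) ℂ (Module.Dual ℂ V)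
  bras_eigen : ∀ N, (bras N).comp (π D.genAs) = D.θs N • bras N

namespace LeonardRep

variable {D : Params} {V : Type*} [AddCommGroup V] [Module ℂ V] (L : LeonardRep D V)

/-- `ξ_M = ⟨θ_M|θ_M⟩`. -/
def ξ (M : Fin (D.d + 1)) : ℂ := L.bra M (L.ket M)

/-- `ξ*_N = ⟨θ*_N|θ*_N⟩`. -/
def ξs (N : Fin (D.d + 1)) : ℂ := L.bras N (L.kets N)

/-- The transition matrix: `|θ*_N⟩ = ∑_M P_{MN} |θ_M⟩`. -/
def P : Matrix (Fin (D.d + 1)) (Fin (D.d + 1)) ℂ :=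
  Matrix.of fun M N => L.ket.repr (L.kets N) M

/-- The coefficients of `⟨θ_M| π(A*) = ∑_{M'} Ã*_{M,M'} ⟨θ_{M'}|`. -/
def Astilde (M M' : Fin (D.d + 1)) : ℂ := L.bra.repr ((L.bra M).comp (L.π D.genAs)) M'

/-- The coefficients of `⟨θ*_N| π(A) = ∑_{N'} Ã_{N,N'} ⟨θ*_{N'}|`. -/
def Atilde (N N' : Fin (D.d + 1)) : ℂ := L.bras.repr ((L.bras N).comp (L.π D.genA)) N'

/-- The dual Bethe state `⟨Ψ₋^N(v̄, m₀)| = ⟨θ₀| π(C⁻(v̄, m₀, N))` (with `α = 0`). -/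
def dualPsiMinus (β : ℂ) (m₀ : ℤ) {N : ℕ} (v : Fin N → ℂ) : Module.Dual ℂ V :=
  (L.bra 0).comp (L.π (D.stringC (-1) 0 β v m₀))

/-- The dual Bethe state `⟨Ψ₊^N(ȳ, m₀)| = ⟨θ*₀| π(C⁺(ȳ, m₀, N))` (with `α = 0`). -/
def dualPsiPlus (β : ℂ) (m₀ : ℤ) {N : ℕ} (y : Fin N → ℂ) : Module.Dual ℂ V :=
  (L.bras 0).comp (L.π (D.stringC 1 0 β y m₀))

/-- `Ñ_{2s}(v̄) = ∏_{k=1}^{2s} (q⁻¹ v_k b(v_k²) Ã*_{k-1,k})⁻¹`. -/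
def Ntilde (v : Fin D.d → ℂ) : ℂ :=
  ∏ k : Fin D.d, (D.q⁻¹ * v k * b (v k ^ 2) * L.Astilde k.castSucc k.succ)⁻¹

/-- `Ñ*_{2s}(ȳ) = ∏_{k=1}^{2s} (-q y_k⁻¹ b(y_k²) Ã_{k-1,k})⁻¹`. -/
def Nstilde (y : Fin D.d → ℂ) : ℂ :=
  ∏ k : Fin D.d, (-D.q * (y k)⁻¹ * b (y k ^ 2) * L.Atilde k.castSucc k.succ)⁻¹

/-- `Ñ_M^{(i)}(v̄') = Ñ*_{2s}(v̄') P_{M,2s} ξ_M / ξ*_{2s}`. -/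
def NtildeInhom (M : Fin (D.d + 1)) (y : Fin D.d → ℂ) : ℂ :=
  L.Nstilde y * L.P M (Fin.last D.d) * (L.ξ M / L.ξs (Fin.last D.d))

/-- `Ñ_N^{*(i)}(ȳ') = Ñ_{2s}(ȳ') (P⁻¹)_{N,2s} ξ*_N / ξ_{2s}`. -/
def NstildeInhom (N : Fin (D.d + 1)) (v : Fin D.d → ℂ) : ℂ :=
  L.Ntilde v * L.P⁻¹ N (Fin.last D.d) * (L.ξs N / L.ξ (Fin.last D.d))

end LeonardRep

end QRacahBethe

end

noncomputable section

namespace QRacahBethe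

open Polynomial

local notation "𝕏" => (Polynomial.X : Polynomial ℂ)

namespace Params

variable (D : Params)

/-! Let `a`, `s` be the transposes of `A`, `A*` on the dual space and `w` the normalized
`q`-commutator of `a` and `s`. At `α = 0` the dynamical operator at `u` transposes to a scalar times
`w - x`, where `x = q u² + q⁻¹ u⁻²` (`tr_KB`). A dual Bethe state is therefore a scalar times `p(w)
f₀`, with `f₀` the vacuum and `p` monic with the spectral variables of the Bethe parameters as
roots.

On such vectors `a` acts through an operator `act` on polynomials (`a_vec`). This follows from the
quadratic relation between `a` and `w` once `a f₀` is known to be a combination of `w f₀` and `f₀`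
(`a_f_zero`). In the variable `u`, `act` is a second-order `q`-difference operator with shifts `u ↦
q^{±1} u` (`eval_act`). The explicit polynomial `chi`, whose values are the products in the
inhomogeneous term, annihilates the vacuum (`vec_chi`).

For monic `p` of degree `2s`, subtracting the right multiples of `chi` and `p` from `act p` leaves
degree below `2s`. The Bethe equations say that the difference vanishes at the `2s` distinct roots
of `p`, so it is zero. Applied to `f₀`, this makes `p(w) f₀` an eigenvector of `a`
(`a_vec_rootPoly`).

The spectrum is simple, so `p(w) f₀` is a multiple of the required eigenvector. Only `w^{2s}`
reaches the last vector of the eigenbasis of `s`, with coefficient the product of the superdiagonal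
entries of `w`; comparing that coordinate fixes the constant (`e_eq_smul_vec`). It becomes the
stated one through `bras_repr_bra`.

The second family follows from the first by exchanging `a` and `s`, inverting `q` and inverting all
Bethe parameters: neither `w` nor the spectral variables change. -/

theorem q_sq_ne_one : D.q ^ 2 ≠ 1 := D.q_not_root_of_unity 2 (by norm_num)

theorem q_four_ne_one : D.q ^ 4 ≠ 1 := D.q_not_root_of_unity 4 (by norm_num)

theorem q_sub_inv_ne_zero : D.q - D.q⁻¹ ≠ 0 := by
  have h0 := D.q_ne_zero
  intro h
  apply D.q_sq_ne_one
  field_simp at h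
  linear_combination h

theorem q_add_inv_ne_zero : D.q + D.q⁻¹ ≠ 0 := by
  have h0 := D.q_ne_zero
  intro h
  apply D.q_four_ne_one
  field_simp at h
  linear_combination (D.q ^ 2 - 1) * h

theorem q_sq_sub_inv_ne_zero : D.q ^ 2 - (D.q ^ 2)⁻¹ ≠ 0 := by
  have h0 := D.q_ne_zero
  intro h
  apply D.q_four_ne_one
  field_simp at h
  linear_combination h

theorem ρ_ne_zero : D.ρ ≠ 0 :=
  mul_ne_zero (neg_ne_zero.2 (mul_ne_zero D.tb_ne_zero D.tc_ne_zero))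
    (pow_ne_zero _ D.q_sq_sub_inv_ne_zero)

/-! ### Abbreviations for the scalars and the spectral variable. -/

/-- `q^{2s}`. -/
def qd : ℂ := D.q ^ (D.d : ℤ)

theorem qd_ne_zero : D.qd ≠ 0 := zpow_ne_zero _ D.q_ne_zero

theorem X_eq : D.X = D.tb * D.qd + D.tc * D.qd⁻¹ := by
  simp [X, qd]

theorem Xs_eq : D.Xs = D.tbs * D.qd + D.tcs * D.qd⁻¹ := by
  simp [Xs, qd]

theorem h0_eq : D.h0 = D.qd * D.q + (D.qd * D.q)⁻¹ := by
  have hq := D.q_ne_zero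
  rw [h0, qd, ← zpow_add_one₀ hq, ← zpow_neg]
  congr 2; ring

/-- The spectral variable `q u² + q⁻¹ u⁻²`. -/
def specVar (u : ℂ) : ℂ := D.q * u ^ 2 + D.q⁻¹ * (u ^ 2)⁻¹

/-- The spectral variable shifted by `u ↦ q u`. -/
def specVarUp (u : ℂ) : ℂ := D.q ^ 3 * u ^ 2 + (D.q ^ 3)⁻¹ * (u ^ 2)⁻¹

/-- The spectral variable shifted by `u ↦ q⁻¹ u`. -/
def specVarDown (u : ℂ) : ℂ := D.q⁻¹ * u ^ 2 + D.q * (u ^ 2)⁻¹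

/-- The constant term of the action of `A` on the vacuum. -/
def vacConst : ℂ := D.X * D.qd⁻¹ - D.Z * D.tbs * D.qd * D.q

/-- `(q + q⁻¹) η / ρ`. -/
def ηr : ℂ := D.X * D.Z - D.Xs * D.h0

/-- `(q + q⁻¹) η* / ρ`. -/
def ηsr : ℂ := D.Xs * D.Z - D.X * D.h0

theorem η_eq : D.η = D.ρ * ((D.q + D.q⁻¹)⁻¹ * D.ηr) := by
  have := D.q_add_inv_ne_zero
  rw [η, ρ, ηr]; field_simp

theorem ηs_eq : D.ηs = D.ρ * ((D.q + D.q⁻¹)⁻¹ * D.ηsr) := by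
  have := D.q_add_inv_ne_zero
  rw [ηs, ρ, ηsr, ← D.tb_mul_tc]; field_simp

/-! ### The action of `A` as a `q`-difference operator on polynomials. -/

/-- The action of `A` on the monomials in the third generator applied to the vacuum. -/
def actMon : ℕ → ℂ[X]
  | 0 => C (D.q * D.tbs) * 𝕏 + C D.vacConst
  | 1 => C (D.q ^ 2) * 𝕏 * (C (D.q * D.tbs) * 𝕏 + C D.vacConst)
      - C (D.q * (D.q - D.q⁻¹) * ((D.q + D.q⁻¹) * (D.tbs + D.tcs) + D.ηr))
  | k + 2 => C (D.q ^ 2 + (D.q ^ 2)⁻¹) * 𝕏 * actMon (k + 1)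
      - (𝕏 ^ 2 + C ((D.q ^ 2 - (D.q ^ 2)⁻¹) ^ 2)) * actMon k
      - (C ((D.q - D.q⁻¹) ^ 2 * D.ηr) * 𝕏
        + C ((D.q ^ 2 - (D.q ^ 2)⁻¹) * (D.q - D.q⁻¹) * D.ηsr)) * 𝕏 ^ k

/-- The action of `A` on polynomials in the third generator applied to the vacuum. -/
def act : ℂ[X] →ₗ[ℂ] ℂ[X] := (Polynomial.basisMonomials ℂ).constr ℂ D.actMon

theorem act_X_pow (k : ℕ) : D.act (𝕏 ^ k) = D.actMon k := by
  have h := (Polynomial.basisMonomials ℂ).constr_basis ℂ D.actMon k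
  simpa only [act, coe_basisMonomials, monomial_one_right_eq_X_pow] using h

theorem act_one : D.act 1 = C (D.q * D.tbs) * 𝕏 + C D.vacConst := by
  rw [← pow_zero 𝕏, act_X_pow, actMon]

theorem act_C (c : ℂ) : D.act (C c) = C c * (C (D.q * D.tbs) * 𝕏 + C D.vacConst) := by
  rw [← mul_one (C c), ← smul_eq_C_mul, map_smul, act_one, smul_eq_C_mul, smul_eq_C_mul, mul_one]

/-- The coefficient of the downward shift in the `q`-difference operator `act`. -/
def shiftDown (u : ℂ) : ℂ :=
  (D.qd * D.q)⁻¹ * (u ^ 2)⁻¹ * ((D.qd * D.q) ^ 2 * u ^ 2 + (u ^ 2)⁻¹ - D.qd * D.q * D.Z)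
    * (D.qd⁻¹ * D.tcs * u ^ 2 + D.X + D.tbs * D.qd * (u ^ 2)⁻¹)

/-- The coefficient of the upward shift in the `q`-difference operator `act`. -/
def shiftUp (u : ℂ) : ℂ :=
  (D.qd * D.q)⁻¹ * (D.q ^ 2 * u ^ 2) *
      (D.qd ^ 2 * (u ^ 2)⁻¹ + D.q ^ 2 * u ^ 2 - D.qd * D.q * D.Z)
    * (D.qd⁻¹ * D.tcs * ((D.q ^ 2)⁻¹ * (u ^ 2)⁻¹) + D.X + D.tbs * D.qd * (D.q ^ 2 * u ^ 2))

/-- This identity and `shift_one` are the two initial values of the recurrence solved in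
`eval_act_monomial`; they determine `shiftUp` and `shiftDown`. -/
theorem shift_zero {u : ℂ} (hu : u ≠ 0) :
    D.shiftUp u - D.shiftDown u = b (D.q * u ^ 2) * D.q *
      (D.specVar u * (D.q * D.tbs * D.specVar u + D.vacConst)
        - (D.q + D.q⁻¹) * (D.tbs + D.tcs) - D.ηr) := by
  have h1 := D.q_ne_zero
  have h2 := D.qd_ne_zero
  simp only [shiftUp, shiftDown, b, specVar, vacConst, ηr, h0_eq, Xs_eq]
  generalize D.X = X
  generalize D.Z = Z
  field_simp
  ring

theorem shift_one {u : ℂ} (hu : u ≠ 0) :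
    (D.q - D.q⁻¹) * (D.shiftUp u * D.specVarUp u - D.shiftDown u * D.specVarDown u) =
      b (D.q * u ^ 2) * (((D.q ^ 2 + (D.q ^ 2)⁻¹ - 1) * D.specVar u) *
        (D.q ^ 2 * D.specVar u * (D.q * D.tbs * D.specVar u + D.vacConst)
          - D.q * (D.q - D.q⁻¹) * ((D.q + D.q⁻¹) * (D.tbs + D.tcs) + D.ηr))
        - (D.specVar u ^ 2 + (D.q ^ 2 - (D.q ^ 2)⁻¹) ^ 2) *
          (D.q * D.tbs * D.specVar u + D.vacConst)
        - ((D.q - D.q⁻¹) ^ 2 * D.ηr * D.specVar u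
          + (D.q ^ 2 - (D.q ^ 2)⁻¹) * (D.q - D.q⁻¹) * D.ηsr)) := by
  have h1 := D.q_ne_zero
  have h2 := D.qd_ne_zero
  simp only [shiftUp, shiftDown, b, specVar, specVarUp, specVarDown, vacConst, ηr, ηsr, h0_eq,
    Xs_eq]
  generalize D.X = X
  generalize D.Z = Z
  field_simp
  ring

/-- The two shifted variables are the roots of the characteristic equation of the recurrence
defining `actMon`. -/
theorem specVar_quadratic_up {u : ℂ} (hu : u ≠ 0) :
    D.specVarUp u ^ 2 = (D.q ^ 2 + (D.q ^ 2)⁻¹) * D.specVar u * D.specVarUp u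
      - (D.specVar u ^ 2 + (D.q ^ 2 - (D.q ^ 2)⁻¹) ^ 2) := by
  have h1 := D.q_ne_zero
  simp only [specVar, specVarUp]
  field_simp
  ring

theorem specVar_quadratic_down {u : ℂ} (hu : u ≠ 0) :
    D.specVarDown u ^ 2 = (D.q ^ 2 + (D.q ^ 2)⁻¹) * D.specVar u * D.specVarDown u
      - (D.specVar u ^ 2 + (D.q ^ 2 - (D.q ^ 2)⁻¹) ^ 2) := by
  have h1 := D.q_ne_zero
  simp only [specVar, specVarDown]
  field_simp
  ring

/-- The inhomogeneous term of `actMon` is proportional to `𝕏 ^ k`, so it cancels in `actMon (k + 1)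
- 𝕏 * actMon k`. What remains is a homogeneous three-term recurrence, solved by powers of the two
shifted variables. -/
theorem eval_act_monomial {u : ℂ} (hu : u ≠ 0) (k : ℕ) :
    b (D.q * u ^ 2) * (D.actMon (k + 1) - 𝕏 * D.actMon k).eval (D.specVar u) =
      (D.q - D.q⁻¹) * (D.shiftUp u * D.specVarUp u ^ k - D.shiftDown u * D.specVarDown u ^ k) := by
  have h1 := D.q_ne_zero
  induction k using Nat.twoStepInduction with
  | zero =>
    have h := D.shift_zero hu
    have : (D.q - D.q⁻¹) * D.q = D.q ^ 2 - 1 := by field_simp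
    simp only [actMon, eval_sub, eval_mul, eval_add, eval_C, eval_X, pow_zero, mul_one]
    linear_combination (-(D.q - D.q⁻¹)) * h + b (D.q * u ^ 2) * D.specVar u *
      (D.q * D.tbs * D.specVar u + D.vacConst) * this.symm
  | one =>
    have h := D.shift_one hu
    simp only [actMon, eval_sub, eval_mul, eval_add, eval_C, eval_X, pow_zero, mul_one, pow_one,
      eval_pow]
    linear_combination -h
  | more k ih1 ih2 =>
    have hp := D.specVar_quadratic_up hu
    have hm := D.specVar_quadratic_down hu
    have e : (D.actMon (k + 2 + 1) - 𝕏 * D.actMon (k + 2)).eval (D.specVar u) =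
        (D.q ^ 2 + (D.q ^ 2)⁻¹) * D.specVar u *
            (D.actMon (k + 1 + 1) - 𝕏 * D.actMon (k + 1)).eval (D.specVar u)
          - (D.specVar u ^ 2 + (D.q ^ 2 - (D.q ^ 2)⁻¹) ^ 2) *
            (D.actMon (k + 1) - 𝕏 * D.actMon k).eval (D.specVar u) := by
      rw [show k + 2 + 1 = (k + 1) + 2 from rfl, actMon, actMon]
      simp only [eval_sub, eval_mul, eval_add, eval_C, eval_X, eval_pow]
      ring
    rw [e]
    linear_combination (D.q ^ 2 + (D.q ^ 2)⁻¹) * D.specVar u * ih2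
      - (D.specVar u ^ 2 + (D.q ^ 2 - (D.q ^ 2)⁻¹) ^ 2) * ih1
      - (D.q - D.q⁻¹) * D.shiftUp u * D.specVarUp u ^ k * hp
      + (D.q - D.q⁻¹) * D.shiftDown u * D.specVarDown u ^ k * hm

theorem eval_act_X_sub_C_mul {u : ℂ} (hu : u ≠ 0) (r : ℂ[X]) :
    b (D.q * u ^ 2) * (D.act ((𝕏 - C (D.specVar u)) * r)).eval (D.specVar u) =
      (D.q - D.q⁻¹) * (D.shiftUp u * r.eval (D.specVarUp u)
        - D.shiftDown u * r.eval (D.specVarDown u)) := by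
  induction r using Polynomial.induction_on' with
  | add p r hp hr =>
    rw [mul_add, map_add, eval_add, eval_add, eval_add]
    linear_combination hp + hr
  | monomial k c =>
    have h := D.eval_act_monomial hu k
    have e : (𝕏 - C (D.specVar u)) * monomial k c
        = c • 𝕏 ^ (k + 1) - (c * D.specVar u) • 𝕏 ^ k := by
      rw [← C_mul_X_pow_eq_monomial, smul_eq_C_mul, smul_eq_C_mul, C_mul]
      ring
    rw [e, map_sub, map_smul, map_smul, act_X_pow, act_X_pow]
    simp only [eval_sub, eval_smul, smul_eq_mul, eval_monomial, eval_mul, eval_X] at h ⊢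
    linear_combination c * h

/-- Isolates the two top coefficients. The recurrence preserves them because `(q² + q⁻²) q^{2k+2} =
q^{2k} + q^{2k+4}`. -/
theorem actMon_eq (k : ℕ) : ∃ R : ℂ[X], R.degree < k ∧
    D.actMon k = C (D.q ^ (2 * k)) * 𝕏 ^ k * (C (D.q * D.tbs) * 𝕏 + C D.vacConst) + R := by
  have h1 := D.q_ne_zero
  induction k using Nat.twoStepInduction with
  | zero => exact ⟨0, by simp, by simp [actMon]⟩
  | one =>
    refine ⟨-C (D.q * (D.q - D.q⁻¹) * ((D.q + D.q⁻¹) * (D.tbs + D.tcs) + D.ηr)), ?_, ?_⟩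
    · rw [degree_neg]
      exact degree_C_lt
    · rw [actMon]; ring_nf
  | more k ih1 ih2 =>
    obtain ⟨R1, hd1, hR1⟩ := ih1
    obtain ⟨R2, hd2, hR2⟩ := ih2
    refine ⟨C (D.q ^ 2 + (D.q ^ 2)⁻¹) * 𝕏 * R2 - 𝕏 ^ 2 * R1
      - C ((D.q ^ 2 - (D.q ^ 2)⁻¹) ^ 2) * D.actMon k
      - (C ((D.q - D.q⁻¹) ^ 2 * D.ηr) * 𝕏
        + C ((D.q ^ 2 - (D.q ^ 2)⁻¹) * (D.q - D.q⁻¹) * D.ηsr)) * 𝕏 ^ k, ?_, ?_⟩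
    · rw [degree_lt_iff_coeff_zero] at *
      intro m hm
      obtain ⟨m, rfl⟩ : ∃ n, m = n + 2 := ⟨m - 2, by omega⟩
      simp only [coeff_sub, hR1, mul_assoc, coeff_C_mul, coeff_add, add_mul, mul_add,
        coeff_X_mul, coeff_X_pow_mul']
      rw [hd2 _ (by push_cast; omega), hd1 _ (by omega), hd1 _ (by omega)]
      have a1 : (𝕏 ^ k : ℂ[X]).coeff (m + 1) = 0 := by
        rw [coeff_X_pow, if_neg (by omega)]
      have a2 : (𝕏 ^ k : ℂ[X]).coeff (m + 2) = 0 := by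
        rw [coeff_X_pow, if_neg (by omega)]
      have a3 : (𝕏 : ℂ[X]).coeff (m + 2 - k) = 0 := by
        rw [coeff_X, if_neg (by omega)]
      have a4 (c : ℂ) : (C c : ℂ[X]).coeff (m + 2 - k) = 0 := by
        rw [coeff_C, if_neg (by omega)]
      simp [a1, a2, a3, a4]
    · rw [actMon, hR2]
      nth_rewrite 1 [add_mul]
      nth_rewrite 1 [hR1]
      have e : C (D.q ^ 2 + (D.q ^ 2)⁻¹) * C (D.q ^ (2 * (k + 1)))
          = C (D.q ^ (2 * k)) + C (D.q ^ (2 * (k + 2))) := by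
        rw [← C_mul, ← C_add]; congr 1; field_simp; ring
      linear_combination 𝕏 ^ (k + 2) * (C (D.q * D.tbs) * 𝕏 + C D.vacConst) * e

theorem coeff_actMon_succ (k : ℕ) : (D.actMon k).coeff (k + 1) = D.q ^ (2 * k) * (D.q * D.tbs) := by
  obtain ⟨R, hd, hR⟩ := D.actMon_eq k
  rw [hR, coeff_add, coeff_eq_zero_of_degree_lt (hd.trans (by exact_mod_cast Nat.lt_succ_self k)),
    mul_assoc, coeff_C_mul, add_comm k 1, coeff_X_pow_mul]
  simp [coeff_C]

theorem coeff_actMon_self (k : ℕ) : (D.actMon k).coeff k = D.q ^ (2 * k) * D.vacConst := by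
  obtain ⟨R, hd, hR⟩ := D.actMon_eq k
  rw [hR, coeff_add, coeff_eq_zero_of_degree_lt hd, mul_assoc, coeff_C_mul, coeff_X_pow_mul']
  simp

theorem coeff_actMon_eq_zero {k n : ℕ} (h : k + 1 < n) : (D.actMon k).coeff n = 0 := by
  obtain ⟨R, hd, hR⟩ := D.actMon_eq k
  rw [hR, coeff_add, coeff_eq_zero_of_degree_lt (hd.trans (by exact_mod_cast (by omega : k < n))),
    mul_assoc, coeff_C_mul, coeff_X_pow_mul', if_pos (by omega), coeff_add, coeff_C_mul, coeff_X,
    coeff_C, if_neg (by omega), if_neg (by omega)]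
  simp

theorem act_eq_sum {p : ℂ[X]} {n : ℕ} (hp : p.natDegree ≤ n) :
    D.act p = ∑ j ∈ Finset.range (n + 1), p.coeff j • D.actMon j := by
  conv_lhs => rw [p.as_sum_range_C_mul_X_pow' (n := n + 1) (by omega)]
  rw [map_sum]
  refine Finset.sum_congr rfl fun j _ => ?_
  rw [← smul_eq_C_mul, map_smul, act_X_pow]

theorem coeff_act_eq_zero {p : ℂ[X]} {n m : ℕ} (hp : p.natDegree ≤ n) (hm : n + 1 < m) :
    (D.act p).coeff m = 0 := by
  rw [D.act_eq_sum hp, finsetSum_coeff]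
  refine Finset.sum_eq_zero fun j hj => ?_
  rw [Finset.mem_range] at hj
  rw [coeff_smul, D.coeff_actMon_eq_zero (by omega), smul_zero]

theorem coeff_act_succ {p : ℂ[X]} {n : ℕ} (hp : p.natDegree ≤ n) :
    (D.act p).coeff (n + 1) = D.q ^ (2 * n) * (D.q * D.tbs) * p.coeff n := by
  rw [D.act_eq_sum hp, finsetSum_coeff, Finset.sum_range_succ, Finset.sum_eq_zero]
  · rw [coeff_smul, coeff_actMon_succ, smul_eq_mul]; ring
  · intro j hj
    rw [Finset.mem_range] at hj
    rw [coeff_smul, D.coeff_actMon_eq_zero (by omega), smul_zero]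

theorem coeff_act_self {p : ℂ[X]} {n : ℕ} (hp : p.natDegree ≤ n + 1) :
    (D.act p).coeff (n + 1) = D.q ^ (2 * (n + 1)) * D.vacConst * p.coeff (n + 1)
      + D.q ^ (2 * n) * (D.q * D.tbs) * p.coeff n := by
  rw [D.act_eq_sum hp, finsetSum_coeff, Finset.sum_range_succ, Finset.sum_range_succ,
    Finset.sum_eq_zero]
  · rw [coeff_smul, coeff_smul, coeff_actMon_succ, coeff_actMon_self, smul_eq_mul, smul_eq_mul]
    ring
  · intro j hj
    rw [Finset.mem_range] at hj
    rw [coeff_smul, D.coeff_actMon_eq_zero (by omega), smul_zero]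

theorem specVarUp_sub {u : ℂ} (hu : u ≠ 0) :
    D.specVarUp u - D.specVar u = (D.q - D.q⁻¹) * b (D.q ^ 2 * u ^ 2) := by
  have h1 := D.q_ne_zero
  simp only [specVar, specVarUp, b]
  field_simp
  ring

theorem specVarDown_sub {u : ℂ} (hu : u ≠ 0) :
    D.specVarDown u - D.specVar u = -(D.q - D.q⁻¹) * b (u ^ 2) := by
  have h1 := D.q_ne_zero
  simp only [specVar, specVarDown, b]
  field_simp
  ring

/-- Split `p` into its value at the spectral variable plus a multiple of `𝕏 - C (D.specVar u)`: the
constant is handled by `act_C`, the rest by `eval_act_X_sub_C_mul`. Denominators are cleared, so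
every nonzero `u` is allowed. -/
theorem eval_act {u : ℂ} (hu : u ≠ 0) (p : ℂ[X]) :
    b (D.q * u ^ 2) * b (u ^ 2) * b (D.q ^ 2 * u ^ 2) * (D.act p).eval (D.specVar u) =
      b (u ^ 2) * D.shiftUp u * (p.eval (D.specVarUp u) - p.eval (D.specVar u))
      + b (D.q ^ 2 * u ^ 2) * D.shiftDown u * (p.eval (D.specVarDown u) - p.eval (D.specVar u))
      + b (D.q * u ^ 2) * b (u ^ 2) * b (D.q ^ 2 * u ^ 2) *
        (D.q * D.tbs * D.specVar u + D.vacConst) * p.eval (D.specVar u) := by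
  obtain ⟨r, hr⟩ : (𝕏 - C (D.specVar u)) ∣ p - C (p.eval (D.specVar u)) := X_sub_C_dvd_sub_C_eval
  have hp : p = C (p.eval (D.specVar u)) + (𝕏 - C (D.specVar u)) * r := by rw [← hr]; ring
  have h := D.eval_act_X_sub_C_mul hu r
  have e1 : p.eval (D.specVarUp u) - p.eval (D.specVar u)
      = (D.q - D.q⁻¹) * b (D.q ^ 2 * u ^ 2) * r.eval (D.specVarUp u) := by
    have := congrArg (eval (D.specVarUp u)) hr
    simp only [eval_sub, eval_mul, eval_X, eval_C] at this
    rw [this, D.specVarUp_sub hu]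
  have e2 : p.eval (D.specVarDown u) - p.eval (D.specVar u)
      = -(D.q - D.q⁻¹) * b (u ^ 2) * r.eval (D.specVarDown u) := by
    have := congrArg (eval (D.specVarDown u)) hr
    simp only [eval_sub, eval_mul, eval_X, eval_C] at this
    rw [this, D.specVarDown_sub hu]
  rw [e1, e2]
  conv_lhs => rw [hp]
  rw [map_add, act_C, eval_add, eval_mul, eval_C]
  simp only [eval_add, eval_mul, eval_X, eval_C]
  linear_combination b (u ^ 2) * b (D.q ^ 2 * u ^ 2) * h

/-! ### Trace of `A` and the polynomial `chi`. -/

/-- The sum `∑ q^{2k-2s}` over `0 ≤ k ≤ 2s`, which is `[2s+1]_q`. -/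
def qsum : ℂ := ∑ k ∈ Finset.range (D.d + 1), D.q ^ (2 * k) * D.qd⁻¹

theorem sub_inv_mul_qsum : (D.q - D.q⁻¹) * D.qsum = D.qd * D.q - (D.qd * D.q)⁻¹ := by
  have h1 := D.q_ne_zero
  have h2 := D.qd_ne_zero
  have h : ∑ k ∈ Finset.range (D.d + 1), D.q ^ (2 * k) * (D.q ^ 2 - 1) = (D.qd * D.q) ^ 2 - 1 := by
    simp only [pow_mul]
    rw [← Finset.sum_mul, geom_sum_mul, qd, zpow_natCast]
    ring
  have e : D.qsum * D.qd * (D.q ^ 2 - 1) = (D.qd * D.q) ^ 2 - 1 := by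
    rw [← h, qsum, Finset.sum_mul, Finset.sum_mul]
    exact Finset.sum_congr rfl fun k _ => by field_simp
  field_simp
  linear_combination e

theorem qsum_inv : ∑ k ∈ Finset.range (D.d + 1), (D.q ^ (2 * k) * D.qd⁻¹)⁻¹ = D.qsum := by
  have h1 := D.q_ne_zero
  rw [qsum, ← Finset.sum_range_reflect]
  refine Finset.sum_congr rfl fun k hk => ?_
  rw [Finset.mem_range] at hk
  rw [qd, zpow_natCast, inv_eq_iff_eq_inv]
  obtain ⟨m, hm⟩ : ∃ m, D.d = k + m := ⟨D.d - k, by omega⟩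
  rw [show D.d + 1 - 1 - k = m by omega, hm]
  field_simp
  ring

theorem qsum_eq : D.qsum = D.qd + D.q⁻¹ * D.brd := by
  have h1 := D.q_ne_zero
  have h2 := D.qd_ne_zero
  have h3 := D.q_sub_inv_ne_zero
  apply mul_left_cancel₀ h3
  have e : D.brd * (D.q - D.q⁻¹) = D.qd - D.qd⁻¹ := by
    rw [brd, div_mul_cancel₀ _ h3, zpow_neg, ← qd]
  rw [sub_inv_mul_qsum, mul_add, mul_left_comm, mul_comm _ D.brd, e]
  field_simp
  ring

theorem sum_θ : ∑ M : Fin (D.d + 1), D.θ M = D.X * D.qsum := by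
  have h2 := D.qd_ne_zero
  have e1 : ∑ k ∈ Finset.range (D.d + 1), D.θ k
      = D.tb * D.qd * ∑ k ∈ Finset.range (D.d + 1), D.q ^ (2 * k) * D.qd⁻¹
        + D.tc * D.qd⁻¹ * ∑ k ∈ Finset.range (D.d + 1), (D.q ^ (2 * k) * D.qd⁻¹)⁻¹ := by
    rw [Finset.mul_sum, Finset.mul_sum, ← Finset.sum_add_distrib]
    refine Finset.sum_congr rfl fun k _ => ?_
    have h1 : D.q ^ (2 * (k : ℤ)) = D.q ^ (2 * k) := by exact_mod_cast zpow_natCast D.q (2 * k)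
    rw [θ, neg_mul, zpow_neg, h1]
    field_simp
  rw [Fin.sum_univ_eq_sum_range D.θ, e1, qsum_inv, ← qsum, X_eq]
  ring

/-- The roots parametrizing the spectrum of the third generator. -/
def root (k : ℕ) : ℂ := D.q ^ (2 * k) * (D.qd⁻¹ * D.ζ ^ 2)

/-- The characteristic polynomial of the third generator. -/
def chi : ℂ[X] := ∏ k ∈ Finset.range (D.d + 1), (𝕏 - C (D.root k + (D.root k)⁻¹))

theorem chi_monic : D.chi.Monic := monic_prod_of_monic _ _ fun _ _ => monic_X_sub_C _

theorem natDegree_chi : D.chi.natDegree = D.d + 1 := by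
  rw [chi, natDegree_prod_of_monic _ _ fun _ _ => monic_X_sub_C _]
  simp only [natDegree_X_sub_C, Finset.sum_const, Finset.card_range, smul_eq_mul, mul_one]

theorem coeff_chi_succ : D.chi.coeff (D.d + 1) = 1 := by
  have := D.chi_monic.coeff_natDegree
  rwa [natDegree_chi] at this

theorem coeff_chi : D.chi.coeff D.d = -(D.Z * D.qsum) := by
  have h : D.chi.nextCoeff = -∑ k ∈ Finset.range (D.d + 1), (D.root k + (D.root k)⁻¹) := by
    rw [chi, Polynomial.prod_X_sub_C_nextCoeff]
  rw [nextCoeff, natDegree_chi, if_neg (by omega), Nat.add_sub_cancel] at h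
  rw [h, Finset.sum_add_distrib, Z, add_mul]
  nth_rewrite 2 [← qsum_inv]
  rw [qsum, Finset.mul_sum, Finset.mul_sum]
  congr 2
  · exact Finset.sum_congr rfl fun k _ => by rw [root]; ring
  · exact Finset.sum_congr rfl fun k _ => by rw [root]; simp only [mul_inv, inv_inv]; ring

/-- Each factor splits as `z + z⁻¹ - (σ + σ⁻¹) = z⁻¹ (z - σ)(z - σ⁻¹)`. The `σ` run through a
geometric progression of ratio `q²`, so replacing `z` by `q² z` telescopes and only end factors
survive; they are cross-multiplied to avoid division. -/
theorem prod_shift {q z s : ℂ} (hq : q ≠ 0) (hz : z ≠ 0) (hs : s ≠ 0) (n : ℕ) :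
    (∏ k ∈ Finset.range n, (q ^ 2 * z + (q ^ 2 * z)⁻¹ - (q ^ (2 * k) * s + (q ^ (2 * k) * s)⁻¹)))
        * ((z - q ^ (2 * n) * (q ^ 2)⁻¹ * s) * (z - s⁻¹)) =
      q ^ (2 * n) * ((z - (q ^ 2)⁻¹ * s) * (z - (q ^ (2 * n) * s)⁻¹)) *
        ∏ k ∈ Finset.range n, (z + z⁻¹ - (q ^ (2 * k) * s + (q ^ (2 * k) * s)⁻¹)) := by
  induction n with
  | zero => simp
  | succ n ih =>
    rw [Finset.prod_range_succ, Finset.prod_range_succ]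
    have e1 : q ^ 2 * z + (q ^ 2 * z)⁻¹ - (q ^ (2 * n) * s + (q ^ (2 * n) * s)⁻¹) =
        q ^ 2 * z⁻¹ * (z - q ^ (2 * n) * (q ^ 2)⁻¹ * s) * (z - (q ^ (2 * (n + 1)) * s)⁻¹) := by
      rw [mul_add, pow_add]; field_simp; ring
    have e2 : z + z⁻¹ - (q ^ (2 * n) * s + (q ^ (2 * n) * s)⁻¹) =
        z⁻¹ * (z - q ^ (2 * (n + 1)) * (q ^ 2)⁻¹ * s) * (z - (q ^ (2 * n) * s)⁻¹) := by
      rw [mul_add, pow_add]; field_simp; ring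
    rw [e1, e2, mul_add 2 n 1, pow_add q (2 * n)]
    linear_combination q ^ 2 * z⁻¹ * (z - (q ^ (2 * n) * q ^ (2 * 1) * s)⁻¹) *
      (z - q ^ (2 * n) * q ^ (2 * 1) * (q ^ 2)⁻¹ * s) * ih

theorem shiftUp_mul_chi {u : ℂ} (hu : u ≠ 0) :
    D.shiftUp u * D.chi.eval (D.specVarUp u) =
      (D.qd * D.q)⁻¹ * (D.q ^ 2 * u ^ 2) *
        (D.qd ^ 2 * D.q ^ 4 * u ^ 2 + (D.q ^ 2)⁻¹ * (u ^ 2)⁻¹ - D.qd * D.q * D.Z) *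
        (D.qd⁻¹ * D.tcs * ((D.q ^ 2)⁻¹ * (u ^ 2)⁻¹) + D.X + D.tbs * D.qd * (D.q ^ 2 * u ^ 2)) *
        D.chi.eval (D.specVar u) := by
  have h1 := D.q_ne_zero
  have h2 := D.qd_ne_zero
  have h3 := D.ζ_ne_zero
  have hs : D.qd⁻¹ * D.ζ ^ 2 ≠ 0 := by positivity
  have h := prod_shift h1 (mul_ne_zero h1 (pow_ne_zero 2 hu)) hs (D.d + 1)
  have hq : D.q ^ (2 * (D.d + 1)) = D.qd ^ 2 * D.q ^ 2 := by rw [qd, zpow_natCast]; ring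
  have e1 : D.specVarUp u = D.q ^ 2 * (D.q * u ^ 2) + (D.q ^ 2 * (D.q * u ^ 2))⁻¹ := by
    rw [specVarUp]; field_simp
  have e2 : D.specVar u = D.q * u ^ 2 + (D.q * u ^ 2)⁻¹ := by
    rw [specVar]; field_simp
  rw [chi, eval_prod, eval_prod]
  simp only [eval_sub, eval_X, eval_C, root, e1, e2]
  rw [hq] at h
  have e3 : D.qd ^ 2 * (u ^ 2)⁻¹ + D.q ^ 2 * u ^ 2 - D.qd * D.q * D.Z = (u ^ 2)⁻¹ *
      ((D.q * u ^ 2 - D.qd ^ 2 * D.q ^ 2 * (D.q ^ 2)⁻¹ * (D.qd⁻¹ * D.ζ ^ 2)) *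
        (D.q * u ^ 2 - (D.qd⁻¹ * D.ζ ^ 2)⁻¹)) := by
    rw [Z]; field_simp; ring
  have e4 : D.qd ^ 2 * D.q ^ 4 * u ^ 2 + (D.q ^ 2)⁻¹ * (u ^ 2)⁻¹ - D.qd * D.q * D.Z = (u ^ 2)⁻¹ *
      (D.qd ^ 2 * D.q ^ 2 * ((D.q * u ^ 2 - (D.q ^ 2)⁻¹ * (D.qd⁻¹ * D.ζ ^ 2)) *
        (D.q * u ^ 2 - (D.qd ^ 2 * D.q ^ 2 * (D.qd⁻¹ * D.ζ ^ 2))⁻¹))) := by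
    rw [Z]; field_simp; ring
  rw [shiftUp, e3, e4]
  linear_combination (D.qd * D.q)⁻¹ * (D.q ^ 2 * u ^ 2) * (u ^ 2)⁻¹ *
    (D.qd⁻¹ * D.tcs * ((D.q ^ 2)⁻¹ * (u ^ 2)⁻¹) + D.X + D.tbs * D.qd * (D.q ^ 2 * u ^ 2)) * h

theorem shiftDown_mul_chi {u : ℂ} (hu : u ≠ 0) :
    D.shiftDown u * D.chi.eval (D.specVarDown u) =
      (D.qd * D.q)⁻¹ * (u ^ 2)⁻¹ *
        (u ^ 2 + D.qd ^ 2 * D.q ^ 2 * (u ^ 2)⁻¹ - D.qd * D.q * D.Z) *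
        (D.qd⁻¹ * D.tcs * u ^ 2 + D.X + D.tbs * D.qd * (u ^ 2)⁻¹) *
        D.chi.eval (D.specVar u) := by
  have h1 := D.q_ne_zero
  have h2 := D.qd_ne_zero
  have h3 := D.ζ_ne_zero
  have hs : D.qd⁻¹ * D.ζ ^ 2 ≠ 0 := by positivity
  have h := prod_shift h1 (inv_ne_zero (mul_ne_zero h1 (pow_ne_zero 2 hu))) hs (D.d + 1)
  have hq : D.q ^ (2 * (D.d + 1)) = D.qd ^ 2 * D.q ^ 2 := by rw [qd, zpow_natCast]; ring
  have e1 : D.specVarDown u = D.q ^ 2 * (D.q * u ^ 2)⁻¹ + (D.q ^ 2 * (D.q * u ^ 2)⁻¹)⁻¹ := by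
    rw [specVarDown]; field_simp; ring
  have e2 : D.specVar u = (D.q * u ^ 2)⁻¹ + (D.q * u ^ 2)⁻¹⁻¹ := by
    rw [specVar]; field_simp; ring
  rw [chi, eval_prod, eval_prod]
  simp only [eval_sub, eval_X, eval_C, root, e1, e2]
  rw [hq] at h
  have e3 : (D.qd * D.q) ^ 2 * u ^ 2 + (u ^ 2)⁻¹ - D.qd * D.q * D.Z = u ^ 2 * D.q ^ 2 *
      (((D.q * u ^ 2)⁻¹ - D.qd ^ 2 * D.q ^ 2 * (D.q ^ 2)⁻¹ * (D.qd⁻¹ * D.ζ ^ 2)) *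
        ((D.q * u ^ 2)⁻¹ - (D.qd⁻¹ * D.ζ ^ 2)⁻¹)) := by
    rw [Z]; field_simp; ring
  have e4 : u ^ 2 + D.qd ^ 2 * D.q ^ 2 * (u ^ 2)⁻¹ - D.qd * D.q * D.Z = u ^ 2 * D.q ^ 2 *
      (D.qd ^ 2 * D.q ^ 2 * (((D.q * u ^ 2)⁻¹ - (D.q ^ 2)⁻¹ * (D.qd⁻¹ * D.ζ ^ 2)) *
        ((D.q * u ^ 2)⁻¹ - (D.qd ^ 2 * D.q ^ 2 * (D.qd⁻¹ * D.ζ ^ 2))⁻¹))) := by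
    rw [Z]; field_simp; ring
  rw [shiftDown, e3, e4]
  linear_combination (D.qd * D.q)⁻¹ * (u ^ 2)⁻¹ * u ^ 2 * D.q ^ 2 *
    (D.qd⁻¹ * D.tcs * u ^ 2 + D.X + D.tbs * D.qd * (u ^ 2)⁻¹) * h

theorem exists_specVar (x : ℂ) : ∃ u, u ≠ 0 ∧ D.specVar u = x := by
  have h1 := D.q_ne_zero
  obtain ⟨s, hs⟩ := IsAlgClosed.exists_pow_nat_eq (x ^ 2 - 4) (n := 2) (by norm_num)
  obtain ⟨u, hu⟩ := IsAlgClosed.exists_pow_nat_eq ((x + s) / (2 * D.q)) (n := 2) (by norm_num)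
  -- With `s² = x² - 4`, the product `(x + s)(x - s)` is `4`, which is why the chosen root of the
  -- quadratic for `q u²` is nonzero.
  have hx : x + s ≠ 0 := by
    intro h
    have : s = -x := by linear_combination h
    rw [this] at hs
    apply (by norm_num : (4 : ℂ) ≠ 0)
    linear_combination hs
  refine ⟨u, ?_, ?_⟩
  · rintro rfl
    rw [zero_pow two_ne_zero, eq_comm, div_eq_zero_iff] at hu
    rcases hu with hu | hu
    · exact hx hu
    · exact mul_ne_zero two_ne_zero h1 hu
  · rw [specVar, hu]
    field_simp
    linear_combination hs

/-- By `shiftUp_mul_chi` and `shiftDown_mul_chi` both shifted values of `chi` contribute explicit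
multiples of its unshifted value, so `act` multiplies `chi` by a function of `u`, which turns out to
be linear in the spectral variable. -/
theorem act_chi : D.act D.chi =
    (C (D.q ^ 3 * D.qd ^ 2 * D.tbs) * 𝕏
      + C (D.q ^ 2 * D.qd * D.X - D.q * D.qd * D.tbs * D.Z)) * D.chi := by
  have h1 := D.q_ne_zero
  have h2 := D.qd_ne_zero
  -- At the spectral variable `N` equals `b(qu²)² b(u²) b(q²u²)`, a multiple of the factor cleared
  -- in `eval_act`; multiplying by it avoids excluding the zeros of that factor.
  obtain ⟨N, hN⟩ : ∃ N : ℂ[X], N = (𝕏 ^ 2 - C 4) * (𝕏 ^ 2 - C ((D.q + D.q⁻¹) ^ 2)) := ⟨_, rfl⟩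
  have hN0 : N ≠ 0 := hN ▸ mul_ne_zero (X_pow_sub_C_ne_zero (by norm_num) _)
    (X_pow_sub_C_ne_zero (by norm_num) _)
  apply mul_left_cancel₀ hN0
  refine Polynomial.funext fun x => ?_
  obtain ⟨u, hu, rfl⟩ := D.exists_specVar x
  have h := D.eval_act hu D.chi
  have hp := D.shiftUp_mul_chi hu
  have hm := D.shiftDown_mul_chi hu
  have e : N.eval (D.specVar u)
      = b (D.q * u ^ 2) * (b (D.q * u ^ 2) * b (u ^ 2) * b (D.q ^ 2 * u ^ 2)) := by
    simp only [hN, eval_mul, eval_sub, eval_pow, eval_X, eval_C, specVar, b]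
    field_simp
    ring
  have key : b (u ^ 2) * ((D.qd * D.q)⁻¹ * (D.q ^ 2 * u ^ 2) *
        (D.qd ^ 2 * D.q ^ 4 * u ^ 2 + (D.q ^ 2)⁻¹ * (u ^ 2)⁻¹ - D.qd * D.q * D.Z) *
        (D.qd⁻¹ * D.tcs * ((D.q ^ 2)⁻¹ * (u ^ 2)⁻¹) + D.X + D.tbs * D.qd * (D.q ^ 2 * u ^ 2))
        - D.shiftUp u) + b (D.q ^ 2 * u ^ 2) * ((D.qd * D.q)⁻¹ * (u ^ 2)⁻¹ *
        (u ^ 2 + D.qd ^ 2 * D.q ^ 2 * (u ^ 2)⁻¹ - D.qd * D.q * D.Z) *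
        (D.qd⁻¹ * D.tcs * u ^ 2 + D.X + D.tbs * D.qd * (u ^ 2)⁻¹) - D.shiftDown u) +
        b (D.q * u ^ 2) * b (u ^ 2) * b (D.q ^ 2 * u ^ 2) *
        (D.q * D.tbs * D.specVar u + D.vacConst) =
      b (D.q * u ^ 2) * b (u ^ 2) * b (D.q ^ 2 * u ^ 2) *
        (D.q ^ 3 * D.qd ^ 2 * D.tbs * D.specVar u
          + (D.q ^ 2 * D.qd * D.X - D.q * D.qd * D.tbs * D.Z)) := by
    simp only [shiftUp, shiftDown, b, specVar, vacConst]
    generalize D.X = X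
    generalize D.Z = Z
    field_simp
    ring
  rw [eval_mul, eval_mul, eval_mul, e, mul_assoc, h]
  simp only [eval_add, eval_mul, eval_X, eval_C]
  linear_combination b (D.q * u ^ 2) * (b (u ^ 2) * hp + b (D.q ^ 2 * u ^ 2) * hm +
    D.chi.eval (D.specVar u) * key)

end Params

/-! ### Askey–Wilson modules and the matrices of `a` and `w` in the eigenbasis of `s`. -/

theorem Params.q_sq_add_one_ne_zero (D : Params) : D.q ^ 2 + 1 ≠ 0 := by
  intro h
  apply D.q_four_ne_one
  linear_combination (D.q ^ 2 - 1) * h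

theorem Params.θs_eq (D : Params) (N : ℕ) :
    D.θs N = D.tbs * D.q ^ (2 * N) + D.tcs * (D.q ^ (2 * N))⁻¹ := by
  have h1 : D.q ^ (2 * (N : ℤ)) = D.q ^ (2 * N) := by exact_mod_cast zpow_natCast D.q (2 * N)
  rw [θs, neg_mul, zpow_neg, h1]

theorem Params.ρ_eq (D : Params) : D.ρ = -(D.tbs * D.tcs) * (D.q ^ 2 - (D.q ^ 2)⁻¹) ^ 2 := by
  rw [ρ, D.tb_mul_tc]

theorem trace_eq_sum_repr {ι U : Type*} [Fintype ι] [AddCommGroup U] [Module ℂ U]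
    (g : Module.Basis ι ℂ U) (T : Module.End ℂ U) :
    LinearMap.trace ℂ U T = ∑ i, g.repr (T (g i)) i := by
  classical
  rw [LinearMap.trace_eq_matrix_trace ℂ g, Matrix.trace]
  exact Finset.sum_congr rfl fun i _ => by rw [Matrix.diag_apply, LinearMap.toMatrix_apply]

/-- A module over the Askey-Wilson algebra, given by the operators `a`, `s` of the two generators,
with eigenbases `e` of `a` and `f` of `s`. -/
structure AWModule (D : Params) (U : Type*) [AddCommGroup U] [Module ℂ U] where
  a : Module.End ℂ U
  s : Module.End ℂ U
  rel_a : a * a * s - (D.q ^ 2 + (D.q ^ 2)⁻¹) • (a * s * a) + s * a * a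
    = D.ρ • s + D.ω • a + D.η • (1 : Module.End ℂ U)
  rel_s : s * s * a - (D.q ^ 2 + (D.q ^ 2)⁻¹) • (s * a * s) + a * s * s
    = D.ρ • a + D.ω • s + D.ηs • (1 : Module.End ℂ U)
  irreducible : ∀ W : Submodule ℂ U, (∀ v ∈ W, a v ∈ W) → (∀ v ∈ W, s v ∈ W) → W = ⊥ ∨ W = ⊤
  e : Module.Basis (Fin (D.d + 1)) ℂ U
  e_eigen : ∀ M, a (e M) = D.θ M • e M
  θ_injective : Function.Injective fun M : Fin (D.d + 1) => D.θ M
  f : Module.Basis (Fin (D.d + 1)) ℂ U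
  f_eigen : ∀ N, s (f N) = D.θs N • f N
  θs_injective : Function.Injective fun N : Fin (D.d + 1) => D.θs N

namespace AWModule

variable {D : Params} {U : Type*} [AddCommGroup U] [Module ℂ U] (S : AWModule D U)

/-- The third generator. -/
def w : Module.End ℂ U :=
  (-((D.q ^ 2 - (D.q ^ 2)⁻¹) * D.ρ⁻¹)) •
    (D.q • (S.a * S.s) - D.q⁻¹ • (S.s * S.a) + (D.ω / (D.q - D.q⁻¹)) • (1 : Module.End ℂ U))

/-- With `w` as third generator each cubic Askey–Wilson relation becomes a `q`-commutator relation
with a linear right-hand side. -/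
theorem rel_w_a : D.q • (S.w * S.a) - D.q⁻¹ • (S.a * S.w) =
    (D.q ^ 2 - (D.q ^ 2)⁻¹) • S.s + ((D.q - D.q⁻¹) * D.ηr) • (1 : Module.End ℂ U) := by
  have h1 := D.q_ne_zero
  have h2 : D.q ^ 2 - 1 ≠ 0 := sub_ne_zero.2 D.q_sq_ne_one
  have h3 := D.ρ_ne_zero
  have h4 := D.q_sq_add_one_ne_zero
  have h := S.rel_a
  rw [D.η_eq] at h
  simp only [w, mul_add, add_mul, mul_sub, sub_mul, smul_mul_assoc, mul_smul_comm, one_mul,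
    mul_one, smul_add, smul_sub, smul_smul, ← mul_assoc] at h ⊢
  linear_combination (norm := skip) ((D.q ^ 2 - (D.q ^ 2)⁻¹) * D.ρ⁻¹) • h
  match_scalars <;> field_simp <;> ring

theorem rel_s_w : D.q • (S.s * S.w) - D.q⁻¹ • (S.w * S.s) =
    (D.q ^ 2 - (D.q ^ 2)⁻¹) • S.a + ((D.q - D.q⁻¹) * D.ηsr) • (1 : Module.End ℂ U) := by
  have h1 := D.q_ne_zero
  have h2 : D.q ^ 2 - 1 ≠ 0 := sub_ne_zero.2 D.q_sq_ne_one
  have h3 := D.ρ_ne_zero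
  have h4 := D.q_sq_add_one_ne_zero
  have h := S.rel_s
  rw [D.ηs_eq] at h
  simp only [w, mul_add, add_mul, mul_sub, sub_mul, smul_mul_assoc, mul_smul_comm, one_mul,
    mul_one, smul_add, smul_sub, smul_smul, ← mul_assoc] at h ⊢
  linear_combination (norm := skip) ((D.q ^ 2 - (D.q ^ 2)⁻¹) * D.ρ⁻¹) • h
  match_scalars <;> field_simp <;> ring

/-- Eliminates `s` between `rel_w_a` and `rel_s_w`. The result carries `a` past two powers of `w`
and is the source of the recurrence in `actMon`. -/
theorem a_mul_w_mul_w : S.a * S.w * S.w = (D.q ^ 2 + (D.q ^ 2)⁻¹) • (S.w * S.a * S.w)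
    - S.w * S.w * S.a - (D.q ^ 2 - (D.q ^ 2)⁻¹) ^ 2 • S.a
    - ((D.q - D.q⁻¹) ^ 2 * D.ηr) • S.w
    - ((D.q ^ 2 - (D.q ^ 2)⁻¹) * (D.q - D.q⁻¹) * D.ηsr) • (1 : Module.End ℂ U) := by
  have h1 := D.q_ne_zero
  have hl := congrArg (fun t => t * S.w) S.rel_w_a
  have hr := congrArg (fun t => S.w * t) S.rel_w_a
  have h := S.rel_s_w
  simp only [mul_add, add_mul, mul_sub, sub_mul, smul_mul_assoc, mul_smul_comm, one_mul,
    mul_one, ← mul_assoc] at hl hr h ⊢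
  linear_combination (norm := skip) (-D.q) • hl + D.q⁻¹ • hr - (D.q ^ 2 - (D.q ^ 2)⁻¹) • h
  match_scalars <;> field_simp <;> ring

theorem repr_s (v : U) (N : Fin (D.d + 1)) : S.f.repr (S.s v) N = D.θs N * S.f.repr v N := by
  conv_lhs => rw [← S.f.sum_repr v, map_sum]
  simp [S.f_eigen, Finsupp.single_apply, mul_comm]

/-- The matrix entries of `a` in the eigenbasis of `s`. -/
def entry (N N' : Fin (D.d + 1)) : ℂ := S.f.repr (S.a (S.f N)) N'

theorem repr_w (N N' : Fin (D.d + 1)) : S.f.repr (S.w (S.f N)) N' =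
    -((D.q ^ 2 - (D.q ^ 2)⁻¹) * D.ρ⁻¹) * ((D.q * D.θs N - D.q⁻¹ * D.θs N') * S.entry N N'
      + if N = N' then D.ω / (D.q - D.q⁻¹) else 0) := by
  simp only [w, LinearMap.smul_apply, LinearMap.add_apply, LinearMap.sub_apply,
    Module.End.mul_apply, Module.End.one_apply, S.f_eigen, map_smul, map_add, map_sub,
    Finsupp.smul_apply, Finsupp.add_apply, Finsupp.sub_apply, smul_eq_mul, repr_s, entry,
    Module.Basis.repr_self, Finsupp.single_apply]
  split_ifs <;> ring

theorem entry_eq (N N' : Fin (D.d + 1)) :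
    (D.θs N' ^ 2 - (D.q ^ 2 + (D.q ^ 2)⁻¹) * D.θs N * D.θs N' + D.θs N ^ 2 - D.ρ) * S.entry N N' =
      if N = N' then D.ω * D.θs N + D.ηs else 0 := by
  have h := congrArg (fun T : Module.End ℂ U => S.f.repr (T (S.f N)) N') S.rel_s
  simp only [LinearMap.smul_apply, LinearMap.add_apply, LinearMap.sub_apply,
    Module.End.mul_apply, Module.End.one_apply, S.f_eigen, map_smul, map_add, map_sub,
    Finsupp.smul_apply, Finsupp.add_apply, Finsupp.sub_apply, smul_eq_mul, repr_s,
    Module.Basis.repr_self, Finsupp.single_apply] at h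
  rw [entry]
  split_ifs at h ⊢ <;> linear_combination h

/-- The trace of `a` is the same in both eigenbases. -/
theorem sum_entry : ∑ N, S.entry N N = D.X * D.qsum := by
  rw [← D.sum_θ]
  have h1 := trace_eq_sum_repr S.f S.a
  rw [trace_eq_sum_repr S.e S.a] at h1
  refine h1.symm.trans (Finset.sum_congr rfl fun M _ => ?_)
  simp [S.e_eigen]

/-- The coefficient in `entry_eq` is a quadratic in `θ*_{N'}` with roots `θ*_{N+1}` and `θ*_{N-1}`.
Distinctness of the eigenvalues keeps it nonzero beyond the superdiagonal. -/
theorem entry_eq_zero {N N' : Fin (D.d + 1)} (h : (N : ℕ) + 1 < N') : S.entry N N' = 0 := by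
  have hq := D.q_ne_zero
  have h1 := S.entry_eq N N'
  have hne : N ≠ N' := fun h' => by rw [h'] at h; omega
  rw [if_neg hne, mul_eq_zero] at h1
  refine h1.resolve_left fun h2 => ?_
  have hlt := N'.2
  have fac : (D.θs N' - D.θs (N + 1)) * (D.θs N' - (D.tbs * (D.q ^ 2)⁻¹ * D.q ^ (2 * (N : ℕ))
      + D.tcs * D.q ^ 2 * (D.q ^ (2 * (N : ℕ)))⁻¹)) = 0 := by
    rw [← h2, D.ρ_eq, D.θs_eq, D.θs_eq, D.θs_eq, mul_add 2 (N : ℕ) 1, pow_add]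
    field_simp
    ring
  rcases mul_eq_zero.1 fac with h3 | h3
  · have := S.θs_injective (a₁ := N') (a₂ := ⟨N + 1, by omega⟩) (sub_eq_zero.1 h3)
    rw [this] at h
    exact lt_irrefl _ h
  · rcases Nat.eq_zero_or_pos N with h0 | h0
    -- For `N = 0` the second root is the formal value `θ*₋₁`, which is not in the spectrum.
    -- Equality with `θ*_{N'}` would force `𝖻* q^{2(N'-1)} = 𝖼*`, hence `θ*_{N'-1} = θ*₀` with `N' ≥
    -- 2`.
    · have e : D.θs (⟨N' - 1, by omega⟩ : Fin (D.d + 1)) = D.θs (⟨0, by omega⟩ : Fin (D.d + 1)) := by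
        obtain ⟨m, hm⟩ : ∃ m, (N' : ℕ) = m + 1 := ⟨N' - 1, by omega⟩
        have hm' : D.q ^ (2 * m) * D.q ^ 4 - 1 ≠ 0 := by
          rw [← pow_add]
          exact sub_ne_zero.2 (D.q_not_root_of_unity _ (by omega))
        rw [h0, hm, D.θs_eq, mul_add 2 m 1, pow_add] at h3
        have h4 : (D.q ^ (2 * m) * D.q ^ 4 - 1) * (D.tbs * D.q ^ (2 * m) - D.tcs) = 0 := by
          field_simp at h3
          apply mul_left_cancel₀ (pow_ne_zero 2 hq)
          linear_combination h3
        have h5 := (mul_eq_zero.1 h4).resolve_left hm'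
        simp only [hm, Nat.add_sub_cancel, D.θs_eq]
        rw [← sub_eq_zero.1 h5]
        field_simp
        ring
      have := S.θs_injective e
      rw [Fin.ext_iff] at this
      simp only at this
      omega
    · have e : D.θs N' = D.θs (⟨N - 1, by omega⟩ : Fin (D.d + 1)) := by
        obtain ⟨m, hm⟩ : ∃ m, (N : ℕ) = m + 1 := ⟨N - 1, by omega⟩
        rw [sub_eq_zero] at h3
        rw [h3]
        simp only [hm, Nat.add_sub_cancel, D.θs_eq]
        rw [mul_add 2 m 1, pow_add]
        field_simp
        ring
      have := S.θs_injective e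
      rw [this] at h
      simp only at h
      omega

theorem f_mem_iff {N : Fin (D.d + 1)} {W : Set (Fin (D.d + 1))} :
    S.f N ∈ ⨅ j ∈ W, LinearMap.ker (S.f.coord j) ↔ N ∉ W := by
  simp only [Submodule.mem_iInf, LinearMap.mem_ker, Module.Basis.coord_apply,
    Module.Basis.repr_self]
  constructor
  · intro h hN
    simpa using h N hN
  · intro h j hj
    rw [Finsupp.single_apply, if_neg]
    rintro rfl
    exact h hj

/-- A vanishing superdiagonal entry would make the span of `f₀, …, f_k` a proper nonzero invariant
subspace. -/
theorem entry_succ_ne_zero (k : Fin D.d) : S.entry k.castSucc k.succ ≠ 0 := by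
  intro h0
  have hmem (v : U) : v ∈ ⨅ j ∈ {j : Fin (D.d + 1) | k.castSucc < j}, LinearMap.ker (S.f.coord j)
      ↔ ∀ j, k.castSucc < j → S.f.repr v j = 0 := by
    simp [Submodule.mem_iInf]
  have hor := S.irreducible
    (⨅ j ∈ {j : Fin (D.d + 1) | k.castSucc < j}, LinearMap.ker (S.f.coord j)) ?_ ?_
  rcases hor with h | h
  · have h1 := (S.f_mem_iff (N := k.castSucc) (W := {j | k.castSucc < j})).2 (by simp)
    rw [h, Submodule.mem_bot] at h1
    exact S.f.ne_zero _ h1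
  · have h1 : S.f k.succ ∈ ⨅ j ∈ {j : Fin (D.d + 1) | k.castSucc < j},
      LinearMap.ker (S.f.coord j) := h ▸ Submodule.mem_top
    rw [f_mem_iff] at h1
    exact h1 k.castSucc_lt_succ
  · intro v hv
    rw [hmem] at hv ⊢
    intro j hj
    conv_lhs => rw [← S.f.sum_repr v, map_sum, map_sum]
    rw [Finsupp.finsetSum_apply]
    refine Finset.sum_eq_zero fun i _ => ?_
    rw [map_smul, map_smul, Finsupp.smul_apply, smul_eq_mul]
    by_cases hi : k.castSucc < i
    · rw [hv i hi, zero_mul]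
    · change _ * S.entry i j = 0
      rw [not_lt, Fin.le_def, Fin.val_castSucc] at hi
      rw [Fin.lt_def, Fin.val_castSucc] at hj
      by_cases hij : (i : ℕ) + 1 < j
      · rw [S.entry_eq_zero hij, mul_zero]
      · have hi' : i = k.castSucc := Fin.ext (by rw [Fin.val_castSucc]; omega)
        have hj' : j = k.succ := Fin.ext (by rw [Fin.val_succ]; omega)
        rw [hi', hj', h0, mul_zero]
  · intro v hv
    rw [hmem] at hv ⊢
    intro j hj
    rw [repr_s, hv j hj, mul_zero]

/-- The superdiagonal entries of the third generator. -/
def kap (k : Fin D.d) : ℂ := D.tbs⁻¹ * (D.q ^ (2 * (k : ℕ) + 1))⁻¹ * S.entry k.castSucc k.succ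

theorem kap_ne_zero (k : Fin D.d) : S.kap k ≠ 0 :=
  mul_ne_zero (mul_ne_zero (inv_ne_zero D.tbs_ne_zero) (inv_ne_zero (pow_ne_zero _ D.q_ne_zero)))
    (S.entry_succ_ne_zero k)

theorem repr_w_succ (k : Fin D.d) : S.f.repr (S.w (S.f k.castSucc)) k.succ = S.kap k := by
  have hq := D.q_ne_zero
  have h2 := D.q_sq_sub_inv_ne_zero
  have h3 := D.tbs_ne_zero
  have h4 := D.tcs_ne_zero
  rw [repr_w, if_neg (Fin.castSucc_lt_succ).ne, kap, D.ρ_eq, Fin.val_castSucc, Fin.val_succ,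
    D.θs_eq, D.θs_eq]
  have e : D.q * (D.tbs * D.q ^ (2 * (k : ℕ)) + D.tcs * (D.q ^ (2 * (k : ℕ)))⁻¹) - D.q⁻¹ *
      (D.tbs * D.q ^ (2 * ((k : ℕ) + 1)) + D.tcs * (D.q ^ (2 * ((k : ℕ) + 1)))⁻¹) =
      D.tcs * (D.q ^ (2 * (k : ℕ) + 1))⁻¹ * (D.q ^ 2 - (D.q ^ 2)⁻¹) := by
    rw [mul_add 2 (k : ℕ) 1, pow_add, pow_add]
    field_simp
    ring
  rw [e]
  generalize D.q ^ 2 - (D.q ^ 2)⁻¹ = Qs at *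
  field_simp
  ring

theorem repr_w_eq_zero {N N' : Fin (D.d + 1)} (h : (N : ℕ) + 1 < N') :
    S.f.repr (S.w (S.f N)) N' = 0 := by
  rw [repr_w, S.entry_eq_zero h, if_neg (fun h' => by rw [h'] at h; omega)]
  ring

/-- Each application of `w` climbs at most one step, so the single path `f₀ → f₁ → ⋯ → f_k` produces
the top coordinate. -/
theorem repr_w_pow {k : ℕ} (hk : k ≤ D.d) :
    (∀ j : Fin (D.d + 1), k < j → S.f.repr ((S.w ^ k) (S.f 0)) j = 0) ∧
      S.f.repr ((S.w ^ k) (S.f 0)) ⟨k, by omega⟩ = ∏ i : Fin k, S.kap (i.castLE hk) := by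
  induction k with
  | zero =>
    refine ⟨fun j hj => ?_, ?_⟩
    · rw [pow_zero, Module.End.one_apply, Module.Basis.repr_self, Finsupp.single_apply, if_neg]
      rintro rfl
      exact lt_irrefl _ hj
    · simp
  | succ k ih =>
    obtain ⟨ih1, ih2⟩ := ih (by omega)
    have e (j : Fin (D.d + 1)) : S.f.repr ((S.w ^ (k + 1)) (S.f 0)) j =
        ∑ i, S.f.repr ((S.w ^ k) (S.f 0)) i * S.f.repr (S.w (S.f i)) j := by
      rw [pow_succ', Module.End.mul_apply]
      conv_lhs => rw [← S.f.sum_repr ((S.w ^ k) (S.f 0)), map_sum, map_sum]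
      rw [Finsupp.finsetSum_apply]
      simp
    refine ⟨fun j hj => ?_, ?_⟩
    · rw [e]
      refine Finset.sum_eq_zero fun i _ => ?_
      by_cases hi : k < i
      · rw [ih1 i hi, zero_mul]
      · rw [S.repr_w_eq_zero (by omega), mul_zero]
    · rw [e, Finset.sum_eq_single ⟨k, by omega⟩, ih2, Fin.prod_univ_castSucc]
      · congr 1
        exact S.repr_w_succ ⟨k, by omega⟩
      · intro i _ hi
        rcases lt_trichotomy k i with h | h | h
        · rw [ih1 i h, zero_mul]
        · exact absurd (Fin.ext h.symm) hi
        · rw [S.repr_w_eq_zero (by simpa using h), mul_zero]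
      · simp

/-! ### Polynomials in `w` applied to the vacuum. -/

/-- The vector `p(w) f₀`. -/
def vec (p : ℂ[X]) : U := aeval S.w p (S.f 0)

theorem vec_sub (p r : ℂ[X]) : S.vec (p - r) = S.vec p - S.vec r := by simp [vec]

theorem vec_C_mul (c : ℂ) (p : ℂ[X]) : S.vec (C c * p) = c • S.vec p := by simp [vec]

theorem vec_mul (p r : ℂ[X]) : S.vec (p * r) = aeval S.w p (S.vec r) := by
  rw [vec, map_mul, Module.End.mul_apply, vec]

theorem vec_eq_sum {p : ℂ[X]} {n : ℕ} (hp : p.natDegree ≤ n) :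
    S.vec p = ∑ i ∈ Finset.range (n + 1), p.coeff i • (S.w ^ i) (S.f 0) := by
  rw [vec, aeval_eq_sum_range' (Nat.lt_succ_of_le hp)]
  simp

theorem repr_vec {p : ℂ[X]} {n : ℕ} (hn : n ≤ D.d) (hp : p.natDegree ≤ n) :
    S.f.repr (S.vec p) ⟨n, by omega⟩ = p.coeff n * ∏ i : Fin n, S.kap (i.castLE hn) := by
  rw [S.vec_eq_sum hp, map_sum, Finsupp.finsetSum_apply, Finset.sum_range_succ,
    Finset.sum_eq_zero, zero_add, map_smul, Finsupp.smul_apply, (S.repr_w_pow hn).2, smul_eq_mul]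
  intro i hi
  rw [Finset.mem_range] at hi
  rw [map_smul, Finsupp.smul_apply, (S.repr_w_pow (by omega)).1 _ hi, smul_zero]

/-- The coordinate at the index `p.natDegree` is the leading coefficient times a nonzero product of
superdiagonal entries. -/
theorem eq_zero_of_vec_eq_zero {p : ℂ[X]} (hp : p.natDegree ≤ D.d) (h : S.vec p = 0) : p = 0 := by
  have h1 := S.repr_vec hp le_rfl
  rw [h, map_zero, Finsupp.zero_apply, eq_comm, mul_eq_zero] at h1
  exact leadingCoeff_eq_zero.1
    (h1.resolve_right (Finset.prod_ne_zero_iff.2 fun i _ => S.kap_ne_zero _))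

theorem linearIndependent_w_pow :
    LinearIndependent ℂ fun k : Fin (D.d + 1) => (S.w ^ (k : ℕ)) (S.f 0) := by
  rw [Fintype.linearIndependent_iff]
  intro g hg i
  have h0 : (∑ k : Fin (D.d + 1), C (g k) * 𝕏 ^ (k : ℕ)) = 0 := by
    apply S.eq_zero_of_vec_eq_zero
    · refine natDegree_sum_le_of_forall_le _ _ fun k _ => ?_
      exact (natDegree_C_mul_X_pow_le _ _).trans (by omega)
    · rw [← hg, vec, map_sum, LinearMap.sum_apply]
      exact Finset.sum_congr rfl fun k _ => by simp
  have h1 := congrArg (fun p => p.coeff (i : ℕ)) h0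
  simp only [finsetSum_coeff, coeff_C_mul, coeff_X_pow, coeff_zero] at h1
  rw [Finset.sum_eq_single i] at h1
  · simpa using h1
  · intro j _ hj
    rw [if_neg fun h => hj (Fin.ext h.symm), mul_zero]
  · simp

/-- The basis `w^k f₀`. -/
def krylov : Module.Basis (Fin (D.d + 1)) ℂ U :=
  basisOfLinearIndependentOfCardEqFinrank S.linearIndependent_w_pow
    (Module.finrank_eq_card_basis S.f).symm

theorem krylov_apply (k : Fin (D.d + 1)) : S.krylov k = (S.w ^ (k : ℕ)) (S.f 0) := by
  simp [krylov]

theorem krylov_repr_vec {p : ℂ[X]} (hp : p.natDegree ≤ D.d) (k : Fin (D.d + 1)) :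
    S.krylov.repr (S.vec p) k = p.coeff k := by
  rw [S.vec_eq_sum hp, ← Fin.sum_univ_eq_sum_range fun i => p.coeff i • (S.w ^ i) (S.f 0)]
  simp only [← krylov_apply]
  rw [Module.Basis.repr_sum_self]

theorem tbs_ne_of_pos (S : AWModule D U) (hd : 0 < D.d) : D.q ^ 2 * D.tbs - D.tcs ≠ 0 := by
  have hq := D.q_ne_zero
  intro h
  have e : D.θs (⟨0, by omega⟩ : Fin (D.d + 1)) = D.θs (⟨1, by omega⟩ : Fin (D.d + 1)) := by
    simp only [D.θs_eq]
    rw [← sub_eq_zero.1 h]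
    field_simp
    ring
  have := S.θs_injective e
  rw [Fin.ext_iff] at this
  simp at this

theorem q_pow_sq_add_one_ne_zero (D : Params) {n : ℕ} (hn : 0 < n) : D.q ^ (2 * n) + 1 ≠ 0 := by
  intro h
  apply D.q_not_root_of_unity (4 * n) (by omega)
  have : D.q ^ (4 * n) = (D.q ^ (2 * n)) ^ 2 := by rw [← pow_mul]; congr 1; ring
  rw [this]
  linear_combination (D.q ^ (2 * n) - 1) * h

/-- The entry of `a` at the vacuum when `θ*₀` coincides with the formal value `θ*₋₁`. -/
theorem entry_zero_of_eq (h : D.tbs = D.q ^ 2 * D.tcs) :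
    S.entry 0 0 = D.X * D.qsum + D.h0 * (D.q * D.tcs * D.Z - D.X) / (2 * (D.q - D.q⁻¹)) *
      (((D.qd * D.q) ^ 2 - 1) / ((D.qd * D.q) ^ 2 + 1) - (D.q ^ 2 - 1) / (D.q ^ 2 + 1)) := by
  have hq := D.q_ne_zero
  have hc := D.tcs_ne_zero
  have hq1 : D.q ^ 2 - 1 ≠ 0 := sub_ne_zero.2 D.q_sq_ne_one
  have hQ := D.qd_ne_zero
  set K := D.h0 * (D.q * D.tcs * D.Z - D.X) / (2 * (D.q - D.q⁻¹)) with hK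
  -- Past the first row the diagonal relation still determines the entry. Its value is proportional
  -- to `p / ((p + 1)(q² p + 1))` with `p = q^{2(N+1)}`, rewritten as a difference so that the sum
  -- over these rows telescopes.
  have key (N : Fin D.d) : S.entry N.succ N.succ =
      -K * ((D.q ^ (2 * ((N : ℕ) + 2)) - 1) / (D.q ^ (2 * ((N : ℕ) + 2)) + 1)
        - (D.q ^ (2 * ((N : ℕ) + 1)) - 1) / (D.q ^ (2 * ((N : ℕ) + 1)) + 1)) := by
    have h1 := S.entry_eq N.succ N.succ
    rw [if_pos rfl] at h1
    have n1 := q_pow_sq_add_one_ne_zero D (Nat.succ_pos N)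
    have n2 := q_pow_sq_add_one_ne_zero D (Nat.succ_pos (N + 1))
    have n3 := sub_ne_zero.2 (D.q_not_root_of_unity (2 * ((N : ℕ) + 1)) (by omega))
    have n4 := sub_ne_zero.2 (D.q_not_root_of_unity (2 * ((N : ℕ) + 2)) (by omega))
    have e2 : D.q ^ (2 * ((N : ℕ) + 2)) = D.q ^ 2 * D.q ^ (2 * ((N : ℕ) + 1)) := by
      rw [← pow_add]; congr 1; ring
    simp only [Nat.succ_eq_add_one, add_assoc, Nat.reduceAdd] at n1 n2
    have hX : D.Xs = D.tcs * D.q * D.h0 := by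
      rw [D.Xs_eq, D.h0_eq, h]; field_simp
    rw [D.θs_eq, Fin.val_succ, D.ρ_eq, Params.ω, Params.ηs, hX, D.tb_mul_tc, h] at h1
    rw [e2] at n2 n4 ⊢
    clear e2
    rw [hK]
    have p0 : D.q ^ (2 * ((N : ℕ) + 1)) ≠ 0 := pow_ne_zero _ hq
    have hq2 := D.q_sq_add_one_ne_zero
    generalize D.q ^ (2 * ((N : ℕ) + 1)) = p at *
    generalize S.entry N.succ N.succ = E at *
    generalize D.X = X at *
    generalize D.Z = Z at *
    generalize D.h0 = H at *
    have m : (p - 1) * (D.q ^ 2 * p - 1) * D.tcs ^ 2 * (D.q ^ 2 - 1) ^ 2 ≠ 0 :=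
      mul_ne_zero (mul_ne_zero (mul_ne_zero n3 n4) (pow_ne_zero 2 hc)) (pow_ne_zero 2 hq1)
    have h5 : E * ((p + 1) * (D.q ^ 2 * p + 1)) = -(H * (D.q * D.tcs * Z - X) * p * D.q) := by
      apply mul_left_cancel₀ m
      linear_combination (norm := (field_simp; ring)) (-(D.q ^ 2 * p ^ 2)) * h1
    have h6 : E = -(H * (D.q * D.tcs * Z - X) * p * D.q) / ((p + 1) * (D.q ^ 2 * p + 1)) := by
      rw [← h5, mul_div_cancel_right₀ _ (mul_ne_zero n1 n2)]
    rw [h6]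
    field_simp
    ring
  -- The first row gives no information here; its entry is the trace minus the telescoped sum.
  have hs := S.sum_entry
  rw [Fin.sum_univ_succ] at hs
  simp only [key] at hs
  rw [← Finset.mul_sum, Fin.sum_univ_eq_sum_range (fun N =>
    ((D.q ^ (2 * (N + 2)) - 1) / (D.q ^ (2 * (N + 2)) + 1)
        - (D.q ^ (2 * (N + 1)) - 1) / (D.q ^ (2 * (N + 1)) + 1))),
    Finset.sum_range_sub (fun N => (D.q ^ (2 * (N + 1)) - 1) / (D.q ^ (2 * (N + 1)) + 1))] at hs
  have e : D.q ^ (2 * (D.d + 1)) = (D.qd * D.q) ^ 2 := by rw [Params.qd, zpow_natCast]; ring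
  rw [e] at hs
  simp only [zero_add, mul_one] at hs
  linear_combination hs

/-- This is the `f₀`-coordinate of `a_f_zero`. The diagonal case of `entry_eq` gives the entry
unless its coefficient vanishes, which happens exactly when `𝖻* = q² 𝖼*`; `entry_zero_of_eq` covers
that case. -/
theorem entry_zero (hd : 0 < D.d) :
    S.entry 0 0 = D.q * D.tbs * (-((D.q ^ 2 - (D.q ^ 2)⁻¹) * D.ρ⁻¹)) *
      ((D.q * D.θs 0 - D.q⁻¹ * D.θs 0) * S.entry 0 0 + D.ω / (D.q - D.q⁻¹)) + D.vacConst := by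
  have hq := D.q_ne_zero
  have hc := D.tcs_ne_zero
  have hb := D.tbs_ne_zero
  have hq1 : D.q ^ 2 - 1 ≠ 0 := sub_ne_zero.2 D.q_sq_ne_one
  have hq2 := D.q_sq_add_one_ne_zero
  have hQ := D.qd_ne_zero
  have hq4 : D.q ^ 4 - 1 ≠ 0 := sub_ne_zero.2 D.q_four_ne_one
  by_cases h : D.tbs = D.q ^ 2 * D.tcs
  · have h1 := S.entry_zero_of_eq h
    have hX : D.Xs = D.tcs * D.q * D.h0 := by
      rw [D.Xs_eq, D.h0_eq, h]; field_simp
    have hS : D.qsum = ((D.qd * D.q) ^ 2 - 1) / (D.qd * (D.q ^ 2 - 1)) := by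
      have := D.sub_inv_mul_qsum
      rw [eq_div_iff (mul_ne_zero hQ hq1)]
      field_simp at this
      linear_combination this
    have hQ2 : D.qd ^ 2 * D.q ^ 2 + 1 ≠ 0 := by
      have := q_pow_sq_add_one_ne_zero D (Nat.succ_pos D.d)
      have e : D.q ^ (2 * (D.d + 1)) = (D.qd * D.q) ^ 2 := by rw [Params.qd, zpow_natCast]; ring
      rwa [Nat.succ_eq_add_one, e, mul_pow] at this
    have h2 : S.entry 0 0 = D.X * D.qsum + (D.q * D.tcs * D.Z - D.X) *
        (((D.qd * D.q) ^ 2 - 1) / (2 * (D.qd * (D.q ^ 2 - 1))) - ((D.qd * D.q) ^ 2 + 1) /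
          (2 * D.qd * (D.q ^ 2 + 1))) := by
      rw [h1, D.h0_eq]
      field_simp
    rw [D.θs_eq, D.ρ_eq, Params.ω, Params.vacConst, hX, D.tb_mul_tc, h2, hS, h, D.h0_eq]
    generalize D.X = X
    generalize D.Z = Z
    simp only [mul_zero, pow_zero, inv_one, mul_one]
    field_simp
    ring
  · have h' : D.tbs - D.q ^ 2 * D.tcs ≠ 0 := sub_ne_zero.2 h
    have h1 := S.entry_eq 0 0
    have h3 := tbs_ne_of_pos S hd
    rw [if_pos rfl, Fin.val_zero, D.θs_eq, D.ρ_eq] at h1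
    simp only [mul_zero, pow_zero, inv_one, mul_one] at h1
    have h2 : S.entry 0 0 = -(D.ω * (D.tbs + D.tcs) + D.ηs) * D.q ^ 4 /
        ((D.q ^ 2 - 1) ^ 2 * (D.tbs - D.q ^ 2 * D.tcs) * (D.q ^ 2 * D.tbs - D.tcs)) := by
      rw [eq_div_iff (mul_ne_zero (mul_ne_zero (pow_ne_zero 2 hq1) h') h3)]
      linear_combination (norm := (field_simp; ring)) (-D.q ^ 4) * h1
    rw [D.θs_eq, D.ρ_eq, h2, Params.ηs, Params.ω, Params.vacConst, D.tb_mul_tc, D.Xs_eq, D.h0_eq]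
    generalize D.X = X
    generalize D.Z = Z
    simp only [mul_zero, pow_zero, inv_one, mul_one]
    field_simp
    ring

/-- Coordinate `0` is `entry_zero`, coordinate `1` is the relation between the superdiagonals of `a`
and `w`, and both sides vanish beyond. -/
theorem a_f_zero (hd : 0 < D.d) :
    S.a (S.f 0) = (D.q * D.tbs) • S.w (S.f 0) + D.vacConst • S.f 0 := by
  apply S.f.repr.injective
  ext j
  rw [map_add, map_smul, map_smul, Finsupp.add_apply, Finsupp.smul_apply, Finsupp.smul_apply,
    Module.Basis.repr_self, Finsupp.single_apply, smul_eq_mul, smul_eq_mul]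
  change S.entry 0 j = _
  rcases lt_trichotomy (j : ℕ) 1 with h | h | h
  · obtain rfl : j = 0 := Fin.ext (by simpa using h)
    rw [repr_w, if_pos rfl, if_pos rfl, mul_one]
    nth_rewrite 1 [S.entry_zero hd]
    rw [Fin.val_zero]
    ring
  · obtain rfl : j = (⟨0, hd⟩ : Fin D.d).succ := Fin.ext h
    have h1 := S.repr_w_succ ⟨0, hd⟩
    rw [kap] at h1
    have e : (⟨0, hd⟩ : Fin D.d).castSucc = 0 := rfl
    rw [e] at h1
    have hq := D.q_ne_zero
    have hb := D.tbs_ne_zero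
    rw [h1, if_neg (Fin.succ_ne_zero _).symm]
    field_simp
    ring
  · rw [S.entry_eq_zero (by simpa using h), S.repr_w_eq_zero (by simpa using h), if_neg]
    · ring
    · rintro rfl
      simp at h

/-- On monomials, the two starting cases of `actMon` come from `a_f_zero` and `rel_w_a`, the
recurrence from `a_mul_w_mul_w`. -/
theorem a_vec (hd : 0 < D.d) (p : ℂ[X]) : S.a (S.vec p) = S.vec (D.act p) := by
  have h0 := S.a_f_zero hd
  have mon (k : ℕ) : S.a ((S.w ^ k) (S.f 0)) = S.vec (D.actMon k) := by
    induction k using Nat.twoStepInduction with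
    | zero => simp [Params.actMon, vec, h0, smul_smul, mul_comm]
    | one =>
      have hq := D.q_ne_zero
      have h := congrArg (fun T : Module.End ℂ U => T (S.f 0)) S.rel_w_a
      simp only [LinearMap.sub_apply, LinearMap.add_apply, LinearMap.smul_apply,
        Module.End.mul_apply, Module.End.one_apply, S.f_eigen, h0, map_add, map_smul, Fin.val_zero] at h
      have e : S.a (S.w (S.f 0)) = D.q • (D.q • ((D.q * D.tbs) • S.w (S.w (S.f 0))
          + D.vacConst • S.w (S.f 0)) - (D.q ^ 2 - (D.q ^ 2)⁻¹) • D.θs 0 • S.f 0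
          - ((D.q - D.q⁻¹) * D.ηr) • S.f 0) := by
        linear_combination (norm := skip) (-D.q) • h
        match_scalars <;> (field_simp; ring)
      rw [pow_one, e, Params.actMon, D.θs_eq]
      simp only [vec, map_sub, map_add, map_mul, aeval_X, aeval_C, LinearMap.sub_apply,
        LinearMap.add_apply, Module.End.mul_apply, Module.algebraMap_end_apply, map_smul]
      match_scalars <;> field_simp
      ring
    | more k ih1 ih2 =>
      have h := congrArg (fun T : Module.End ℂ U => T ((S.w ^ k) (S.f 0))) S.a_mul_w_mul_w
      simp only [LinearMap.sub_apply, LinearMap.smul_apply, Module.End.mul_apply,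
        Module.End.one_apply] at h
      rw [pow_succ', Module.End.mul_apply] at ih2
      rw [pow_succ', pow_succ', Module.End.mul_apply, Module.End.mul_apply, h, ih1, ih2,
        Params.actMon]
      simp only [vec, map_sub, map_add, map_mul, map_pow, aeval_X, aeval_C, LinearMap.sub_apply,
        LinearMap.add_apply, Module.End.mul_apply, Module.algebraMap_end_apply, pow_two]
      module
  rw [S.vec_eq_sum le_rfl, D.act_eq_sum le_rfl, map_sum]
  rw [vec, map_sum, LinearMap.sum_apply]
  refine Finset.sum_congr rfl fun k _ => ?_
  rw [map_smul, mon, map_smul, LinearMap.smul_apply, vec]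

/-- In fact `chi` is the characteristic polynomial `m` of `w`. Computing the trace of `a` in the
Krylov basis shows that their subleading coefficients agree. Then `p = chi - m` has degree `k < d`
and satisfies `act p = lin * p`; if it were nonzero, leading coefficients would give `q^{2(d-k)+2} =
1`. -/
theorem vec_chi (hd : 0 < D.d) : S.vec D.chi = 0 := by
  have hq := D.q_ne_zero
  have hb := D.tbs_ne_zero
  have hQ := D.qd_ne_zero
  have := Module.Finite.of_basis S.f
  obtain ⟨n, hn⟩ : ∃ n, D.d = n + 1 := ⟨D.d - 1, by omega⟩
  set m := S.w.charpoly with hm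
  have hmm : m.Monic := S.w.charpoly_monic
  have hmd : m.natDegree = D.d + 1 := by
    rw [hm, LinearMap.charpoly_natDegree, Module.finrank_eq_card_basis S.f, Fintype.card_fin]
  have hm1 : m.coeff (D.d + 1) = 1 := by rw [← hmd]; exact hmm.coeff_natDegree
  have hmv (r : ℂ[X]) : S.vec (r * m) = 0 := by
    rw [vec_mul, vec, hm, LinearMap.aeval_self_charpoly, LinearMap.zero_apply, map_zero]
  have hqd : D.q ^ (2 * D.d) = D.qd ^ 2 := by rw [Params.qd, zpow_natCast]; ring
  have htr : m.coeff D.d = D.chi.coeff D.d := by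
    have h1 := trace_eq_sum_repr S.krylov S.a
    rw [trace_eq_sum_repr S.f S.a] at h1
    have h2 : ∑ i, S.f.repr (S.a (S.f i)) i = D.X * D.qsum := S.sum_entry
    rw [h2] at h1
    have e (k : Fin (D.d + 1)) : S.a (S.krylov k) = S.vec (D.actMon k) := by
      rw [← D.act_X_pow, ← S.a_vec hd, krylov_apply]
      simp [vec]
    have hdeg (k : ℕ) : (D.actMon k).natDegree ≤ k + 1 :=
      natDegree_le_iff_coeff_eq_zero.2 fun N hN => D.coeff_actMon_eq_zero hN
    have diag (k : Fin D.d) : S.krylov.repr (S.a (S.krylov k.castSucc)) k.castSucc =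
        D.q ^ (2 * (k : ℕ)) * D.vacConst := by
      rw [e, S.krylov_repr_vec ((hdeg _).trans (by simp)), D.coeff_actMon_self,
        Fin.val_castSucc]
    have last : S.krylov.repr (S.a (S.krylov (Fin.last D.d))) (Fin.last D.d) =
        D.q ^ (2 * D.d) * D.vacConst - D.q ^ (2 * D.d) * (D.q * D.tbs) * m.coeff D.d := by
      -- `actMon d` has degree `d + 1`, one too many for Krylov coordinates, so it is reduced modulo
      -- `m`.
      have e2 : S.vec (D.actMon D.d) =
          S.vec (D.actMon D.d - C (D.q ^ (2 * D.d) * (D.q * D.tbs)) * m) := by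
        rw [vec_sub, hmv, sub_zero]
      rw [e, Fin.val_last, e2, S.krylov_repr_vec, Fin.val_last, coeff_sub, coeff_C_mul,
        D.coeff_actMon_self]
      rw [natDegree_le_iff_coeff_eq_zero]
      intro N hN
      rw [coeff_sub, coeff_C_mul]
      rcases Nat.lt_or_ge (D.d + 1) N with h | h
      · rw [D.coeff_actMon_eq_zero h, coeff_eq_zero_of_natDegree_lt (by omega)]
        ring
      · obtain rfl : N = D.d + 1 := by omega
        rw [D.coeff_actMon_succ, hm1]
        ring
    have hsum : D.qsum * D.qd = ∑ k ∈ Finset.range (D.d + 1), D.q ^ (2 * k) := by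
      rw [Params.qsum, Finset.sum_mul]
      exact Finset.sum_congr rfl fun k _ => by field_simp
    rw [Fin.sum_univ_castSucc, last] at h1
    simp only [diag] at h1
    rw [← Finset.sum_mul, Fin.sum_univ_eq_sum_range (fun k => D.q ^ (2 * k))] at h1
    rw [Finset.sum_range_succ] at hsum
    rw [D.coeff_chi]
    have h3 : D.qd ^ 2 * (D.q * D.tbs) * m.coeff D.d
        = D.qd ^ 2 * (D.q * D.tbs) * -(D.Z * D.qsum) := by
      have h4 : D.X * D.qsum = D.qsum * D.qd * D.vacConst
          - D.qd ^ 2 * (D.q * D.tbs) * m.coeff D.d := by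
        rw [hsum, h1, hqd]
        ring
      rw [Params.vacConst] at h4
      have h5 : D.qsum * D.qd * (D.X * D.qd⁻¹ - D.Z * D.tbs * D.qd * D.q) =
        D.X * D.qsum - D.qd ^ 2 * (D.q * D.tbs) * (D.Z * D.qsum) := by field_simp
      linear_combination h4 + h5
    exact mul_left_cancel₀ (mul_ne_zero (pow_ne_zero 2 hQ) (mul_ne_zero hq hb)) h3
  set p := D.chi - m with hp
  have hpv : S.vec p = S.vec D.chi := by
    rw [hp, vec_sub, ← one_mul m, hmv, sub_zero]
  have hpd : p.natDegree ≤ n := by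
    rw [natDegree_le_iff_coeff_eq_zero]
    intro N hN
    rw [hp, coeff_sub]
    rcases Nat.lt_or_ge (D.d + 1) N with h | h
    · rw [coeff_eq_zero_of_natDegree_lt (by rw [D.natDegree_chi]; exact h),
        coeff_eq_zero_of_natDegree_lt (by omega), sub_zero]
    · rcases Nat.lt_or_ge D.d N with h' | h'
      · obtain rfl : N = D.d + 1 := by omega
        rw [D.coeff_chi_succ, hm1, sub_self]
      · obtain rfl : N = D.d := by omega
        rw [htr, sub_self]
  set lin : ℂ[X] := C (D.q ^ 3 * D.qd ^ 2 * D.tbs) * 𝕏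
      + C (D.q ^ 2 * D.qd * D.X - D.q * D.qd * D.tbs * D.Z) with hlin
  have hav : S.vec (D.act p - lin * p) = 0 := by
    rw [vec_sub, ← S.a_vec hd, hpv, S.a_vec hd, D.act_chi, ← hlin, vec_mul, vec_mul, hpv, sub_self]
  have hk : p = 0 := by
    by_contra hne
    set k := p.natDegree with hkdef
    have hc : (lin * p).coeff (k + 1) = D.q ^ 3 * D.qd ^ 2 * D.tbs * p.coeff k := by
      rw [hlin, add_mul, mul_assoc, coeff_add, coeff_C_mul, coeff_C_mul, coeff_X_mul,
        coeff_eq_zero_of_natDegree_lt (n := k + 1) (by omega)]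
      ring
    have hz : D.act p - lin * p = 0 := by
      -- Since `k < d`, both `act p` and `lin * p` have degree at most `d`, where `vec` is
      -- injective.
      apply S.eq_zero_of_vec_eq_zero _ hav
      rw [natDegree_le_iff_coeff_eq_zero]
      intro N hN
      obtain ⟨N, rfl⟩ : ∃ N', N = N' + 1 := ⟨N - 1, by omega⟩
      rw [coeff_sub, D.coeff_act_eq_zero (n := k) le_rfl (by omega), hlin, add_mul, mul_assoc,
        coeff_add, coeff_C_mul, coeff_C_mul, coeff_X_mul,
        coeff_eq_zero_of_natDegree_lt (by omega), coeff_eq_zero_of_natDegree_lt (by omega)]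
      ring
    have h1 := congrArg (fun t => t.coeff (k + 1)) hz
    simp only [coeff_sub, coeff_zero] at h1
    rw [hc, D.coeff_act_succ le_rfl, ← hqd] at h1
    have hlc : p.coeff k ≠ 0 := by
      rw [hkdef, coeff_natDegree]
      exact leadingCoeff_ne_zero.2 hne
    have h2 : D.q ^ (2 * k) * (D.q * D.tbs * p.coeff k) * (D.q ^ (2 * (D.d - k) + 2) - 1) = 0 := by
      have e : D.q ^ (2 * D.d) = D.q ^ (2 * k) * D.q ^ (2 * (D.d - k)) := by
        rw [← pow_add]; congr 1; omega
      rw [e] at h1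
      rw [pow_add]
      linear_combination -h1
    rcases mul_eq_zero.1 h2 with h3 | h3
    · exact mul_ne_zero (pow_ne_zero _ hq) (mul_ne_zero (mul_ne_zero hq hb) hlc) h3
    · exact D.q_not_root_of_unity _ (by omega) (sub_eq_zero.1 h3)
  rw [← hpv, hk]
  simp [vec]

/-! ### Bethe vectors are eigenvectors. -/

/-- The polynomial with the given family of roots. -/
def rootPoly {n : ℕ} (x : Fin n → ℂ) : ℂ[X] := ∏ j, (𝕏 - C (x j))

/-- Polynomial form of the dual inhomogeneous Bethe equations. -/
def _root_.QRacahBethe.Params.IsBethe (D : Params) (y : Fin D.d → ℂ) : Prop :=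
  ∀ i, (D.q - D.q⁻¹) *
      (D.shiftUp (y i) * ∏ j ∈ Finset.univ.erase i, (D.specVarUp (y i) - D.specVar (y j))
        - D.shiftDown (y i) *
          ∏ j ∈ Finset.univ.erase i, (D.specVarDown (y i) - D.specVar (y j))) =
    b (D.q * y i ^ 2) * (D.q ^ (2 * D.d) * (D.q * D.tbs)) * D.chi.eval (D.specVar (y i))

theorem a_vec_rootPoly (hd : 0 < D.d) {y : Fin D.d → ℂ} (hy : ∀ i, y i ≠ 0)
    (hyb : ∀ i, b (D.q * y i ^ 2) ≠ 0) (hinj : Function.Injective fun i => D.specVar (y i))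
    (hB : D.IsBethe y) :
    S.a (S.vec (rootPoly fun i => D.specVar (y i))) =
      D.dualEigPlus y • S.vec (rootPoly fun i => D.specVar (y i)) := by
  have hq := D.q_ne_zero
  have hQ := D.qd_ne_zero
  obtain ⟨n, hn⟩ : ∃ n, D.d = n + 1 := ⟨D.d - 1, by omega⟩
  set x := fun i => D.specVar (y i) with hx
  set p := rootPoly x with hp
  have hpm : p.Monic := monic_prod_of_monic _ _ fun _ _ => monic_X_sub_C _
  have hpd : p.natDegree = D.d := by
    rw [hp, rootPoly, natDegree_prod_of_monic _ _ fun _ _ => monic_X_sub_C _]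
    simp only [natDegree_X_sub_C, Finset.sum_const, Finset.card_univ, Fintype.card_fin,
      smul_eq_mul, mul_one]
  have hp1 : p.coeff D.d = 1 := by rw [← hpd]; exact hpm.coeff_natDegree
  have hp2 : p.coeff n = -∑ i, x i := by
    have h : p.nextCoeff = -∑ i, x i := by
      rw [hp, rootPoly, Polynomial.prod_X_sub_C_nextCoeff]
    rw [nextCoeff, hpd, if_neg (by omega)] at h
    rwa [show D.d - 1 = n by omega] at h
  have hqd : D.q ^ (2 * D.d) = D.qd ^ 2 := by rw [Params.qd, zpow_natCast]; ring
  -- The multiple of `chi` cancels the coefficient of degree `d + 1`; `dualEigPlus` is precisely the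
  -- scalar that cancels degree `d`. The rest has degree below `d` and vanishes at the `d` distinct
  -- points `x i`, by the Bethe equations and `p.eval (x i) = 0`.
  have hE : D.act p - C (D.q ^ (2 * D.d) * (D.q * D.tbs)) * D.chi - C (D.dualEigPlus y) * p
      = 0 := by
    refine Polynomial.eq_zero_of_degree_lt_of_eval_index_eq_zero (s := Finset.univ)
      (v := x) hinj.injOn ?_ ?_
    · rw [Finset.card_univ, Fintype.card_fin, degree_lt_iff_coeff_zero]
      intro N hN
      rw [coeff_sub, coeff_sub, coeff_C_mul, coeff_C_mul]
      rcases Nat.lt_or_ge (D.d + 1) N with h | h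
      · rw [D.coeff_act_eq_zero hpd.le h, coeff_eq_zero_of_natDegree_lt (p := p) (by omega),
          coeff_eq_zero_of_natDegree_lt (by rw [D.natDegree_chi]; exact h)]
        ring
      · rcases Nat.lt_or_ge D.d N with h' | h'
        · obtain rfl : N = D.d + 1 := by omega
          rw [D.coeff_act_succ hpd.le, D.coeff_chi_succ, hp1,
            coeff_eq_zero_of_natDegree_lt (p := p) (by omega)]
          ring
        · obtain rfl : N = D.d := by omega
          have h1 := D.coeff_act_self (p := p) (n := n) (hpd.le.trans hn.le)
          rw [← hn, hp1, hp2] at h1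
          have e1 : D.q ^ (2 * n) = D.qd ^ 2 * (D.q ^ 2)⁻¹ := by
            rw [← hqd, hn, mul_add, pow_add]
            field_simp
          rw [h1, D.coeff_chi, hp1, hqd, e1, Params.dualEigPlus, Params.vacConst, D.qsum_eq]
          have e2 : D.q ^ (2 * (D.d : ℤ)) = D.qd ^ 2 := by
            rw [Params.qd, ← zpow_natCast, ← zpow_mul]; congr 1; ring
          have e3 : D.q ^ (-(D.d : ℤ)) = D.qd⁻¹ := by rw [Params.qd, zpow_neg]
          rw [e2, e3]
          change _ - _ - D.qd ^ 2 * (_ + _ - D.q⁻¹ * D.tbs * ∑ i, x i) * 1 = 0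
          field_simp
          ring
    · intro i _
      have hdecomp : p = (𝕏 - C (x i)) * ∏ j ∈ Finset.univ.erase i, (𝕏 - C (x j)) := by
        rw [hp, rootPoly, Finset.mul_prod_erase _ (fun j => 𝕏 - C (x j)) (Finset.mem_univ i)]
      have h1 := D.eval_act_X_sub_C_mul (hy i) (∏ j ∈ Finset.univ.erase i, (𝕏 - C (x j)))
      have h2 := hB i
      have h3 : p.eval (x i) = 0 := by rw [hdecomp]; simp
      apply (mul_eq_zero.1 _).resolve_left (hyb i)
      rw [eval_sub, eval_sub, eval_mul, eval_mul, h3, eval_C]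
      change _ = (D.q - D.q⁻¹) * _ at h1
      rw [show D.specVar (y i) = x i from rfl, ← hdecomp, eval_prod, eval_prod] at h1
      simp only [eval_sub, eval_X, eval_C] at h1
      linear_combination h1 + h2
  rw [S.a_vec hd]
  have h1 := congrArg S.vec hE
  rw [vec_sub, vec_sub, vec_C_mul, vec_C_mul, S.vec_chi hd, smul_zero, sub_zero] at h1
  rw [← sub_eq_zero, h1]
  simp [vec]

theorem prod_kap_ne_zero : ∏ k, S.kap k ≠ 0 := Finset.prod_ne_zero_iff.2 fun k _ => S.kap_ne_zero k

theorem e_eq_smul_vec {y : Fin D.d → ℂ} (hy : ∀ i, y i ≠ 0)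
    (hyb : ∀ i, b (D.q * y i ^ 2) ≠ 0) (hinj : Function.Injective fun i => D.specVar (y i))
    (hB : D.IsBethe y) {M : Fin (D.d + 1)} (hM : D.θ M = D.dualEigPlus y) :
    S.e M = (S.f.repr (S.e M) (Fin.last D.d) * (∏ k, S.kap k)⁻¹) •
      S.vec (rootPoly fun i => D.specVar (y i)) := by
  set p := rootPoly fun i => D.specVar (y i) with hp
  have hpm : p.Monic := monic_prod_of_monic _ _ fun _ _ => monic_X_sub_C _
  have hpd : p.natDegree = D.d := by
    rw [hp, rootPoly, natDegree_prod_of_monic _ _ fun _ _ => monic_X_sub_C _]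
    simp only [natDegree_X_sub_C, Finset.sum_const, Finset.card_univ, Fintype.card_fin,
      smul_eq_mul, mul_one]
  have hlast : S.f.repr (S.vec p) (Fin.last D.d) = ∏ k, S.kap k := by
    have h := S.repr_vec le_rfl hpd.le
    rw [show p.coeff D.d = 1 by rw [← hpd]; exact hpm.coeff_natDegree, one_mul] at h
    exact h
  obtain ⟨c, hc⟩ : ∃ c : ℂ, S.vec p = c • S.e M := by
    refine ⟨S.e.repr (S.vec p) M, ?_⟩
    -- For `d = 0` the space is a line and proportionality is automatic.
    rcases Nat.eq_zero_or_pos D.d with hd | hd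
    · have : Subsingleton (Fin (D.d + 1)) := by
        rw [hd, zero_add]; infer_instance
      conv_lhs => rw [← S.e.sum_repr (S.vec p)]
      rw [Fintype.sum_subsingleton _ M]
    · have ha := S.a_vec_rootPoly hd hy hyb hinj hB
      rw [← hp, ← hM] at ha
      conv_lhs => rw [← S.e.sum_repr (S.vec p)]
      refine Finset.sum_eq_single M (fun j _ hj => ?_) (by simp)
      have h1 := congrArg (fun v => S.e.repr v j) ha
      conv_lhs at h1 => rw [← S.e.sum_repr (S.vec p), map_sum]
      simp only [map_smul, S.e_eigen, map_sum, Finsupp.finsetSum_apply, Finsupp.smul_apply,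
        Module.Basis.repr_self, Finsupp.single_apply, smul_eq_mul, mul_ite, mul_one, mul_zero,
        Finset.sum_ite_eq', Finset.mem_univ, if_true] at h1
      have h2 : (D.θ j - D.θ M) * S.e.repr (S.vec p) j = 0 := by linear_combination h1
      rcases mul_eq_zero.1 h2 with h3 | h3
      · exact absurd (S.θ_injective (sub_eq_zero.1 h3)) hj
      · rw [h3, zero_smul]
  rw [hc, map_smul, Finsupp.smul_apply, smul_eq_mul] at hlast
  have hne := S.prod_kap_ne_zero
  rw [← hlast] at hne
  rw [hc, smul_smul, ← hlast, mul_assoc, mul_comm, mul_assoc,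
    inv_mul_cancel₀ hne, one_smul]

end AWModule

/-! ### The exchange symmetry and the polynomial form of the Bethe equations. -/

theorem b_inv (x : ℂ) : b x⁻¹ = -b x := by simp [b]

namespace Params

variable (D : Params)

/-- The parameters obtained by exchanging the roles of the two generators and inverting `q`. -/
abbrev swap : Params where
  d := D.d
  q := D.q⁻¹
  r := D.r⁻¹
  tb := D.tcs
  tc := D.tbs
  tbs := D.tc
  tcs := D.tb
  ζ := D.ζ
  χ := D.χ
  q_ne_zero := inv_ne_zero D.q_ne_zero
  q_not_root_of_unity := fun n hn h => D.q_not_root_of_unity n hn (by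
    rwa [inv_pow, inv_eq_one] at h)
  r_sq := by rw [inv_pow, D.r_sq]
  tb_ne_zero := D.tcs_ne_zero
  tc_ne_zero := D.tbs_ne_zero
  tbs_ne_zero := D.tc_ne_zero
  tcs_ne_zero := D.tb_ne_zero
  ζ_ne_zero := D.ζ_ne_zero
  χ_ne_zero := D.χ_ne_zero
  tb_mul_tc := by rw [mul_comm, ← D.tb_mul_tc, mul_comm]

theorem swap_qd : D.swap.qd = D.qd⁻¹ := by simp [qd]

theorem swap_θ (N : ℕ) : D.swap.θ N = D.θs N := by
  rw [θ, θs, inv_zpow', inv_zpow', neg_mul, neg_neg]; ring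

theorem swap_θs (N : ℕ) : D.swap.θs N = D.θ N := by
  rw [θ, θs, inv_zpow', inv_zpow', neg_mul, neg_neg]; ring

theorem swap_X : D.swap.X = D.Xs := by
  rw [X_eq, Xs_eq, swap_qd, inv_inv]; ring

theorem swap_Xs : D.swap.Xs = D.X := by
  rw [X_eq, Xs_eq, swap_qd, inv_inv]; ring

theorem swap_Z : D.swap.Z = D.Z := rfl

theorem swap_h0 : D.swap.h0 = D.h0 := by
  rw [h0_eq, h0_eq, swap_qd, ← mul_inv, inv_inv]; ring

theorem swap_ρ : D.swap.ρ = D.ρ := by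
  rw [ρ, ρ, D.tb_mul_tc, inv_pow, inv_inv]; ring

theorem swap_ω : D.swap.ω = D.ω := by
  rw [ω, ω, D.tb_mul_tc, swap_X, swap_Xs, swap_Z, swap_h0, inv_inv]; ring

theorem swap_η : D.swap.η = D.ηs := by
  rw [η, ηs, swap_X, swap_Xs, swap_Z, swap_h0, inv_inv, inv_pow, inv_inv, add_comm D.q⁻¹]; ring

theorem swap_ηs : D.swap.ηs = D.η := by
  rw [η, ηs, swap_X, swap_Xs, swap_Z, swap_h0, inv_inv, inv_pow, inv_inv, add_comm D.q⁻¹]; ring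

theorem swap_specVar (u : ℂ) : D.swap.specVar u⁻¹ = D.specVar u := by
  rw [specVar, specVar, inv_inv, inv_pow, inv_inv]; ring

theorem swap_specVarUp (u : ℂ) : D.swap.specVarUp u⁻¹ = D.specVarUp u := by
  rw [specVarUp, specVarUp, inv_pow, inv_inv, inv_pow, inv_inv]; ring

theorem swap_specVarDown (u : ℂ) : D.swap.specVarDown u⁻¹ = D.specVarDown u := by
  rw [specVarDown, specVarDown, inv_inv, inv_pow, inv_inv]; ring

theorem swap_dualEigPlus (y : Fin D.d → ℂ) :
    D.swap.dualEigPlus (fun i => (y i)⁻¹) = D.dualEigMinus y := by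
  have hb : D.swap.brd = D.brd := by
    rw [brd, brd, inv_zpow', inv_zpow', neg_neg, inv_inv, ← neg_sub, ← neg_sub D.q, neg_div_neg_eq]
  rw [dualEigPlus, dualEigMinus, hb, swap_Z, swap_X]
  simp only [inv_zpow', inv_inv, inv_pow, neg_neg, neg_mul]
  congr 3
  exact Finset.sum_congr rfl fun j _ => by ring

/-- Pairing the `ζ`-factor of index `k` with the `ζ⁻¹`-factor of index `d - k` turns each pair into
one linear factor of `chi`. -/
theorem prod_b_eq_eval_chi {u : ℂ} (hu : u ≠ 0) :
    ∏ k ∈ Finset.range (D.d + 1), b (D.r ^ (1 + 2 * (k : ℤ) - D.d) * D.ζ * u)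
      * b (D.r ^ (1 + 2 * (k : ℤ) - D.d) * D.ζ⁻¹ * u) = D.chi.eval (D.specVar u) := by
  have hζ := D.ζ_ne_zero
  have hr : D.r ≠ 0 := by
    intro h
    apply D.q_ne_zero
    rw [← D.r_sq, h, zero_pow two_ne_zero]
  rw [Finset.prod_mul_distrib,
    ← Finset.prod_range_reflect (fun k : ℕ => b (D.r ^ (1 + 2 * (k : ℤ) - D.d) * D.ζ⁻¹ * u)),
    ← Finset.prod_mul_distrib, chi, eval_prod]
  refine Finset.prod_congr rfl fun k hk => ?_
  rw [Finset.mem_range] at hk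
  have e0 : ((D.d + 1 - 1 - k : ℕ) : ℤ) = D.d - k := by omega
  have e1 : D.r ^ (1 + 2 * (k : ℤ) - D.d) = D.r * (D.r ^ (2 * (k : ℤ)) * (D.r ^ (D.d : ℤ))⁻¹) := by
    rw [zpow_sub₀ hr, zpow_add₀ hr, zpow_one]; ring
  have e2 : D.r ^ (1 + 2 * ((D.d : ℤ) - k) - D.d)
      = D.r * (D.r ^ (2 * (k : ℤ)) * (D.r ^ (D.d : ℤ))⁻¹)⁻¹ := by
    rw [show 1 + 2 * ((D.d : ℤ) - k) - D.d = 1 + D.d - 2 * k by ring, zpow_sub₀ hr, zpow_add₀ hr,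
      zpow_one]
    field_simp
  have e3 : D.root k = (D.r ^ (2 * (k : ℤ)) * (D.r ^ (D.d : ℤ))⁻¹) ^ 2 * D.ζ ^ 2 := by
    have h1 : D.r ^ (2 * (k : ℤ)) = D.q ^ k := by
      rw [zpow_mul, zpow_natCast, ← D.r_sq]; rfl
    have h2 : D.qd = (D.r ^ (D.d : ℤ)) ^ 2 := by
      rw [qd, ← D.r_sq, zpow_natCast, zpow_natCast]; ring
    rw [root, h1, h2, pow_mul']
    ring
  rw [e0, e1, e2, specVar, ← D.r_sq]
  simp only [eval_sub, eval_X, eval_C, e3, b]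
  have hn : D.r ^ (2 * (k : ℤ)) * (D.r ^ (D.d : ℤ))⁻¹ ≠ 0 :=
    mul_ne_zero (zpow_ne_zero _ hr) (inv_ne_zero (zpow_ne_zero _ hr))
  generalize D.r ^ (2 * (k : ℤ)) * (D.r ^ (D.d : ℤ))⁻¹ = R at *
  generalize D.r = r at *
  field_simp
  ring

theorem swap_eval_chi {u : ℂ} (hu : u ≠ 0) :
    D.swap.chi.eval (D.specVar u) = D.chi.eval (D.specVar u) := by
  rw [← D.prod_b_eq_eval_chi hu, ← swap_specVar, ← D.swap.prod_b_eq_eval_chi (inv_ne_zero hu)]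
  refine Finset.prod_congr rfl fun k _ => ?_
  have e1 : D.r⁻¹ ^ (1 + 2 * (k : ℤ) - D.d) * D.ζ * u⁻¹
      = (D.r ^ (1 + 2 * (k : ℤ) - D.d) * D.ζ⁻¹ * u)⁻¹ := by
    rw [inv_zpow, mul_inv, mul_inv, inv_inv]
  have e2 : D.r⁻¹ ^ (1 + 2 * (k : ℤ) - D.d) * D.ζ⁻¹ * u⁻¹
      = (D.r ^ (1 + 2 * (k : ℤ) - D.d) * D.ζ * u)⁻¹ := by
    rw [inv_zpow, mul_inv, mul_inv]
  rw [e1, e2, b_inv, b_inv]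
  ring

theorem f_eq {u v : ℂ} (hu : u ≠ 0) (hv : v ≠ 0) :
    D.f u v = (D.specVarDown u - D.specVar v) / (D.specVar u - D.specVar v) := by
  have hq := D.q_ne_zero
  have e1 : b (D.q * v / u) * b (u * v) = -(D.specVarDown u - D.specVar v) := by
    simp only [b, specVarDown, specVar]; field_simp; ring
  have e2 : b (v / u) * b (D.q * u * v) = -(D.specVar u - D.specVar v) := by
    simp only [b, specVar]; field_simp; ring
  rw [f, e1, e2, neg_div_neg_eq]

theorem h_eq {u v : ℂ} (hu : u ≠ 0) (hv : v ≠ 0) :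
    D.h u v = (D.specVarUp u - D.specVar v) / (D.specVar u - D.specVar v) := by
  have hq := D.q_ne_zero
  have e1 : b (D.q ^ 2 * u * v) * b (D.q * u / v) = D.specVarUp u - D.specVar v := by
    simp only [b, specVarUp, specVar]; field_simp; ring
  have e2 : b (D.q * u * v) * b (u / v) = D.specVar u - D.specVar v := by
    simp only [b, specVar]; field_simp; ring
  rw [h, e1, e2]

theorem b_mul_b {u v : ℂ} (hu : u ≠ 0) (hv : v ≠ 0) :
    b (u * v⁻¹) * b (D.q * u * v) = D.specVar u - D.specVar v := by
  have hq := D.q_ne_zero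
  simp only [b, specVar]; field_simp; ring

theorem q_zpow_neg_sub : D.q ^ (-(D.d : ℤ) - 1) = (D.qd * D.q)⁻¹ := by
  rw [zpow_sub₀ D.q_ne_zero, zpow_neg, ← qd, zpow_one, mul_inv, div_eq_mul_inv]

theorem q_zpow_neg : D.q ^ (-(D.d : ℤ)) = D.qd⁻¹ := by rw [zpow_neg, ← qd]

theorem q_zpow_add : D.q ^ ((D.d : ℤ) + 1) = D.qd * D.q := by
  rw [zpow_add₀ D.q_ne_zero, ← qd, zpow_one]

theorem q_zpow_sub : D.q ^ ((D.d : ℤ) - 1) = D.qd * D.q⁻¹ := by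
  rw [zpow_sub₀ D.q_ne_zero, ← qd, zpow_one, div_eq_mul_inv]

theorem tc_eq : D.tc = D.tbs * D.tcs / D.tb := by
  rw [eq_div_iff D.tb_ne_zero, mul_comm, D.tb_mul_tc]

/-- The two `ζ`-factors multiply to the bracket containing `Z`, the last two to the one containing
`X`; the latter uses `𝖻𝖼 = 𝖻*𝖼*`. -/
theorem Λ₁_plus {u : ℂ} (hu : u ≠ 0) : u⁻¹ * D.Λ₁ 1 u = D.shiftDown u := by
  have h1 := D.q_ne_zero
  have h2 := D.qd_ne_zero
  have h3 := D.ζ_ne_zero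
  have h4 := D.tb_ne_zero
  have h5 := D.tcs_ne_zero
  rw [Λ₁, shiftDown, q_zpow_neg_sub, q_zpow_add, X_eq, Z, zpow_neg, ← qd, D.tc_eq]
  norm_num
  field_simp
  ring

theorem Λ₂_plus {u : ℂ} (hu : u ≠ 0) : D.q ^ 2 * u ^ 3 * D.Λ₂ 1 u =
    b (u ^ 2) / b (D.q * u ^ 2) * D.shiftUp u := by
  have h1 := D.q_ne_zero
  have h2 := D.qd_ne_zero
  have h3 := D.ζ_ne_zero
  have h4 := D.tb_ne_zero
  have h5 := D.tcs_ne_zero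
  rw [Λ₂, shiftUp, q_zpow_neg_sub, q_zpow_sub, X_eq, Z, zpow_neg, ← qd, D.tc_eq]
  have e : D.q * u ^ 2 - D.q⁻¹ * (u ^ 2)⁻¹ = b (D.q * u ^ 2) := by rw [b, mul_inv]
  rw [e, show u ^ 2 - (u ^ 2)⁻¹ = b (u ^ 2) from rfl]
  generalize b (u ^ 2) = B1
  generalize b (D.q * u ^ 2) = B2
  norm_num
  field_simp
  ring

theorem Λ₁_minus {u : ℂ} (hu : u ≠ 0) : u * D.Λ₁ (-1) u = D.swap.shiftDown u⁻¹ := by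
  have h1 := D.q_ne_zero
  have h2 := D.qd_ne_zero
  have h3 := D.ζ_ne_zero
  have h4 := D.tb_ne_zero
  have h5 := D.tcs_ne_zero
  rw [Λ₁, shiftDown, q_zpow_neg_sub, q_zpow_add, swap_X, swap_Z, Xs_eq, Z, q_zpow_neg, ← qd,
    swap_qd, show D.swap.tbs = D.tc from rfl, D.tc_eq]
  norm_num
  field_simp
  ring

theorem Λ₂_minus {u : ℂ} (hu : u ≠ 0) : (D.q ^ 2 * u ^ 3)⁻¹ * D.Λ₂ (-1) u =
    b (u ^ 2) / b (D.q * u ^ 2) * D.swap.shiftUp u⁻¹ := by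
  have h1 := D.q_ne_zero
  have h2 := D.qd_ne_zero
  have h3 := D.ζ_ne_zero
  have h4 := D.tb_ne_zero
  have h5 := D.tcs_ne_zero
  rw [Λ₂, shiftUp, q_zpow_neg_sub, q_zpow_sub, swap_X, swap_Z, Xs_eq, Z, q_zpow_neg, ← qd,
    swap_qd, show D.swap.tbs = D.tc from rfl, D.tc_eq]
  have e : D.q * u ^ 2 - D.q⁻¹ * (u ^ 2)⁻¹ = b (D.q * u ^ 2) := by rw [b, mul_inv]
  rw [e, show u ^ 2 - (u ^ 2)⁻¹ = b (u ^ 2) from rfl]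
  generalize b (u ^ 2) = B1
  generalize b (D.q * u ^ 2) = B2
  norm_num
  field_simp
  ring

variable {D} in
theorem NontrivialAdmissible.ne_zero {y : Fin D.d → ℂ} (hy : D.NontrivialAdmissible y)
    (i : Fin D.d) : y i ≠ 0 := (hy.1 i).1

variable {D} in
theorem NontrivialAdmissible.b_sq_ne_zero {y : Fin D.d → ℂ} (hy : D.NontrivialAdmissible y)
    (i : Fin D.d) : b (y i ^ 2) ≠ 0 := sub_ne_zero.2 (hy.1 i).2.1

variable {D} in
theorem NontrivialAdmissible.injective {y : Fin D.d → ℂ} (hy : D.NontrivialAdmissible y) :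
    Function.Injective fun i => D.specVar (y i) := by
  intro i j h
  by_contra hij
  exact hy.2 i j hij (by rw [symRoot, symRoot]; exact congrArg (· / (D.q + D.q⁻¹)) h)

/-- In spectral variables the products of `f`, of `h` and of the `b`-factors share one denominator,
nonzero for admissible roots; multiplying by it clears the equation. -/
theorem Etilde_eq (ε : ℤ) {y : Fin D.d → ℂ} (hy : D.NontrivialAdmissible y) (i : Fin D.d) :
    D.Etilde ε y i * ∏ j ∈ Finset.univ.erase i, (D.specVar (y i) - D.specVar (y j)) =
      b (y i ^ 2) / b (D.q * y i ^ 2) * (y i ^ (-ε) * D.Λ₁ ε (y i)) *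
        ∏ j ∈ Finset.univ.erase i, (D.specVarDown (y i) - D.specVar (y j))
      - (D.q ^ 2 * y i ^ 3) ^ ε * D.Λ₂ ε (y i) *
        ∏ j ∈ Finset.univ.erase i, (D.specVarUp (y i) - D.specVar (y j))
      + D.νtilde ε * (b (y i ^ 2) / b D.q) * D.chi.eval (D.specVar (y i)) := by
  have h0 := hy.ne_zero
  have hP : ∏ j ∈ Finset.univ.erase i, (D.specVar (y i) - D.specVar (y j)) ≠ 0 := by
    rw [Finset.prod_ne_zero_iff]
    intro j hj h
    exact (Finset.ne_of_mem_erase hj) (hy.injective (sub_eq_zero.1 h)).symm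
  have hf : ∏ j ∈ Finset.univ.erase i, D.f (y i) (y j) =
      (∏ j ∈ Finset.univ.erase i, (D.specVarDown (y i) - D.specVar (y j))) /
        ∏ j ∈ Finset.univ.erase i, (D.specVar (y i) - D.specVar (y j)) := by
    rw [← Finset.prod_div_distrib]
    exact Finset.prod_congr rfl fun j _ => D.f_eq (h0 i) (h0 j)
  have hh : ∏ j ∈ Finset.univ.erase i, D.h (y i) (y j) =
      (∏ j ∈ Finset.univ.erase i, (D.specVarUp (y i) - D.specVar (y j))) /
        ∏ j ∈ Finset.univ.erase i, (D.specVar (y i) - D.specVar (y j)) := by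
    rw [← Finset.prod_div_distrib]
    exact Finset.prod_congr rfl fun j _ => D.h_eq (h0 i) (h0 j)
  have hb : ∏ j ∈ Finset.univ.erase i, b (y i * (y j)⁻¹) * b (D.q * y i * y j) =
      ∏ j ∈ Finset.univ.erase i, (D.specVar (y i) - D.specVar (y j)) :=
    Finset.prod_congr rfl fun j _ => D.b_mul_b (h0 i) (h0 j)
  rw [Etilde, hf, hh, hb, D.prod_b_eq_eval_chi (h0 i)]
  generalize ∏ j ∈ Finset.univ.erase i, (D.specVar (y i) - D.specVar (y j)) = P at *
  field_simp

theorem isBethe_plus {y : Fin D.d → ℂ} (hy : D.NontrivialAdmissible y)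
    (hE : ∀ j, D.Etilde 1 y j = 0) : D.IsBethe y := by
  intro i
  have h1 := D.Etilde_eq 1 hy i
  have hq := D.q_sub_inv_ne_zero
  have hu := hy.b_sq_ne_zero i
  have hqu := (hy.1 i).2.2
  have hν : D.νtilde 1 = D.q ^ (2 * D.d) * (D.q * D.tbs) := by
    rw [νtilde, if_pos rfl, zpow_add₀ D.q_ne_zero, zpow_one]
    have : D.q ^ (2 * (D.d : ℤ)) = D.q ^ (2 * D.d) := by exact_mod_cast zpow_natCast D.q (2 * D.d)
    rw [this]; ring
  have hbq : b D.q = D.q - D.q⁻¹ := rfl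
  rw [hE i, zero_mul, zpow_neg, zpow_one, zpow_one, D.Λ₁_plus (hy.ne_zero i),
    D.Λ₂_plus (hy.ne_zero i), hν, hbq] at h1
  generalize D.q - D.q⁻¹ = q1 at *
  generalize b (y i ^ 2) = B1 at *
  generalize b (D.q * y i ^ 2) = B2 at *
  apply mul_left_cancel₀ hu
  linear_combination (norm := (field_simp; ring)) (q1 * B2) * h1

theorem isBethe_minus {y : Fin D.d → ℂ} (hy : D.NontrivialAdmissible y)
    (hE : ∀ j, D.Etilde (-1) y j = 0) : D.swap.IsBethe fun i => (y i)⁻¹ := by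
  intro i
  have h1 := D.Etilde_eq (-1) hy i
  have hq := D.q_sub_inv_ne_zero
  have hu := hy.b_sq_ne_zero i
  have hqu := (hy.1 i).2.2
  have hν : D.νtilde (-1) = D.q⁻¹ ^ (2 * D.d) * (D.q⁻¹ * D.tc) := by
    rw [νtilde, if_neg (by norm_num), zpow_sub₀ D.q_ne_zero, zpow_neg, zpow_one]
    have : D.q ^ (2 * (D.d : ℤ)) = D.q ^ (2 * D.d) := by exact_mod_cast zpow_natCast D.q (2 * D.d)
    rw [this, inv_pow]
    ring
  have hbq : b D.q = D.q - D.q⁻¹ := rfl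
  rw [hE i, zero_mul, neg_neg, zpow_one, zpow_neg, zpow_one, D.Λ₁_minus (hy.ne_zero i),
    D.Λ₂_minus (hy.ne_zero i), hν, hbq] at h1
  simp only [swap_specVar, swap_specVarUp, swap_specVarDown, D.swap_eval_chi (hy.ne_zero i)]
  have e1 : b (D.q⁻¹ * (y i)⁻¹ ^ 2) = -b (D.q * y i ^ 2) := by
    rw [← b_inv, mul_inv, inv_pow]
  rw [e1, inv_inv, ← neg_sub D.q]
  generalize D.q - D.q⁻¹ = q1 at *
  generalize b (y i ^ 2) = B1 at *
  generalize b (D.q * y i ^ 2) = B2 at *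
  apply mul_left_cancel₀ hu
  linear_combination (norm := (field_simp; ring)) (-(q1 * B2)) * h1

end Params

/-! ### The transposed representation. -/

theorem rel_of_qComm {R : Type*} [Ring R] [Algebra ℂ R] {q : ℂ} (hq : q ≠ 0) (x y : R) :
    qComm q⁻¹ x (qComm q x y) = x * x * y - (q ^ 2 + (q ^ 2)⁻¹) • (x * y * x) + y * x * x := by
  simp only [qComm, mul_sub, sub_mul, mul_smul_comm, smul_mul_assoc, smul_sub, smul_smul, inv_inv,
    ← mul_assoc]
  match_scalars <;> field_simp
  ring

theorem dual_apply_eq_zero {ι V : Type*} [AddCommGroup V] [Module ℂ V] {T : Module.End ℂ V}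
    {t : ι → ℂ} (ht : Function.Injective t) {g : ι → V} {h : ι → Module.Dual ℂ V}
    (hg : ∀ i, T (g i) = t i • g i) (hh : ∀ i, (h i).comp T = t i • h i) {i j : ι} (hij : i ≠ j) :
    h i (g j) = 0 := by
  have h1 := LinearMap.congr_fun (hh i) (g j)
  rw [LinearMap.comp_apply, hg, map_smul, LinearMap.smul_apply, smul_eq_mul, smul_eq_mul] at h1
  have h2 : (t j - t i) * h i (g j) = 0 := by linear_combination h1
  exact (mul_eq_zero.1 h2).resolve_left (sub_ne_zero.2 fun h => hij (ht h).symm)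

theorem dual_apply_self_ne_zero {ι V : Type*} [Fintype ι] [AddCommGroup V] [Module ℂ V]
    {g : Module.Basis ι ℂ V} {h : Module.Basis ι ℂ (Module.Dual ℂ V)}
    (hgh : ∀ i j, i ≠ j → h i (g j) = 0) (i : ι) : h i (g i) ≠ 0 := by
  intro h0
  apply h.ne_zero i
  refine g.ext fun j => ?_
  rw [LinearMap.zero_apply]
  by_cases hij : i = j
  · rw [← hij, h0]
  · exact hgh i j hij

namespace LeonardRep

variable {D : Params} {V : Type*} [AddCommGroup V] [Module ℂ V] (L : LeonardRep D V)

theorem relA : L.π D.genA * L.π D.genA * L.π D.genAs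
      - (D.q ^ 2 + (D.q ^ 2)⁻¹) • (L.π D.genA * L.π D.genAs * L.π D.genA)
      + L.π D.genAs * L.π D.genA * L.π D.genA
    = D.ρ • L.π D.genAs + D.ω • L.π D.genA + D.η • (1 : Module.End ℂ V) := by
  have h := congrArg L.π (RingQuot.mkAlgHom_rel ℂ (AWRel.aw1 (q := D.q) (ρ := D.ρ) (ω := D.ω)
    (η := D.η) (ηs := D.ηs)))
  rw [rel_of_qComm D.q_ne_zero] at h
  simpa only [map_add, map_sub, map_smul, map_mul, map_one, Params.genA, Params.genAs] using h

theorem relAs : L.π D.genAs * L.π D.genAs * L.π D.genA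
      - (D.q ^ 2 + (D.q ^ 2)⁻¹) • (L.π D.genAs * L.π D.genA * L.π D.genAs)
      + L.π D.genA * L.π D.genAs * L.π D.genAs
    = D.ρ • L.π D.genA + D.ω • L.π D.genAs + D.ηs • (1 : Module.End ℂ V) := by
  have h := congrArg L.π (RingQuot.mkAlgHom_rel ℂ (AWRel.aw2 (q := D.q) (ρ := D.ρ) (ω := D.ω)
    (η := D.η) (ηs := D.ηs)))
  rw [rel_of_qComm D.q_ne_zero] at h
  simpa only [map_add, map_sub, map_smul, map_mul, map_one, Params.genA, Params.genAs] using h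

/-- The transposed operator of an element of the Askey-Wilson algebra. -/
def tr (x : D.AW) : Module.End ℂ (Module.Dual ℂ V) := (L.π x).dualMap

theorem tr_apply (x : D.AW) (φ : Module.Dual ℂ V) : L.tr x φ = φ.comp (L.π x) := rfl

theorem tr_mul (x y : D.AW) : L.tr (x * y) = L.tr y * L.tr x := by
  ext φ v; simp [tr_apply]

theorem tr_add (x y : D.AW) : L.tr (x + y) = L.tr x + L.tr y := by
  ext φ v; simp [tr_apply]

theorem tr_sub (x y : D.AW) : L.tr (x - y) = L.tr x - L.tr y := by
  ext φ v; simp [tr_apply]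

theorem tr_smul (c : ℂ) (x : D.AW) : L.tr (c • x) = c • L.tr x := by
  ext φ v; simp [tr_apply]

theorem tr_one : L.tr 1 = 1 := by
  ext φ v; simp [tr_apply]

theorem tr_relA : L.tr D.genA * L.tr D.genA * L.tr D.genAs
      - (D.q ^ 2 + (D.q ^ 2)⁻¹) • (L.tr D.genA * L.tr D.genAs * L.tr D.genA)
      + L.tr D.genAs * L.tr D.genA * L.tr D.genA
    = D.ρ • L.tr D.genAs + D.ω • L.tr D.genA + D.η • (1 : Module.End ℂ (Module.Dual ℂ V)) := by
  ext φ v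
  have h := congrArg φ (LinearMap.congr_fun L.relA v)
  simp only [LinearMap.add_apply, LinearMap.sub_apply, LinearMap.smul_apply, Module.End.mul_apply,
    Module.End.one_apply, map_add, map_sub, map_smul, smul_eq_mul, tr_apply,
    LinearMap.comp_apply] at h ⊢
  linear_combination h

theorem tr_relAs : L.tr D.genAs * L.tr D.genAs * L.tr D.genA
      - (D.q ^ 2 + (D.q ^ 2)⁻¹) • (L.tr D.genAs * L.tr D.genA * L.tr D.genAs)
      + L.tr D.genA * L.tr D.genAs * L.tr D.genAs
    = D.ρ • L.tr D.genA + D.ω • L.tr D.genAs + D.ηs • (1 : Module.End ℂ (Module.Dual ℂ V)) := by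
  ext φ v
  have h := congrArg φ (LinearMap.congr_fun L.relAs v)
  simp only [LinearMap.add_apply, LinearMap.sub_apply, LinearMap.smul_apply, Module.End.mul_apply,
    Module.End.one_apply, map_add, map_sub, map_smul, smul_eq_mul, tr_apply,
    LinearMap.comp_apply] at h ⊢
  linear_combination h

theorem stable_of_gens {W : Submodule ℂ V} (hA : ∀ v ∈ W, L.π D.genA v ∈ W)
    (hAs : ∀ v ∈ W, L.π D.genAs v ∈ W) (x : D.AW) : ∀ v ∈ W, L.π x v ∈ W := by
  obtain ⟨z, rfl⟩ := RingQuot.mkAlgHom_surjective ℂ (AWRel D.q D.ρ D.ω D.η D.ηs) x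
  induction z using FreeAlgebra.induction with
  | grade0 c =>
    intro v hv
    rw [AlgHom.commutes, AlgHom.commutes, Module.algebraMap_end_apply]
    exact W.smul_mem c hv
  | grade1 g =>
    cases g
    · exact hA
    · exact hAs
  | mul x y hx hy =>
    intro v hv
    rw [map_mul, map_mul, Module.End.mul_apply]
    exact hx _ (hy _ hv)
  | add x y hx hy =>
    intro v hv
    rw [map_add, map_add, LinearMap.add_apply]
    exact W.add_mem (hx _ hv) (hy _ hv)

/-- In finite dimension, an invariant subspace of the dual is the annihilator of its coannihilator,
which is invariant in `V`. -/
theorem dual_irreducible (W : Submodule ℂ (Module.Dual ℂ V)) (hA : ∀ φ ∈ W, L.tr D.genA φ ∈ W)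
    (hAs : ∀ φ ∈ W, L.tr D.genAs φ ∈ W) : W = ⊥ ∨ W = ⊤ := by
  have := Module.Finite.of_basis L.ket
  have hW : W.dualCoannihilator.dualAnnihilator = W :=
    Subspace.dualCoannihilator_dualAnnihilator_eq
  have hst := L.stable_of_gens (W := W.dualCoannihilator)
    (fun v hv => by
      rw [Submodule.mem_dualCoannihilator] at hv ⊢
      exact fun φ hφ => hv _ (hA φ hφ))
    (fun v hv => by
      rw [Submodule.mem_dualCoannihilator] at hv ⊢
      exact fun φ hφ => hv _ (hAs φ hφ))
  rcases L.irreducible _ hst with h | h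
  · right
    rw [← hW, h, Submodule.dualAnnihilator_bot]
  · left
    rw [← hW, h, Submodule.dualAnnihilator_top]

/-- The transposed representation. -/
def dualModule : AWModule D (Module.Dual ℂ V) where
  a := L.tr D.genA
  s := L.tr D.genAs
  rel_a := L.tr_relA
  rel_s := L.tr_relAs
  irreducible := L.dual_irreducible
  e := L.bra
  e_eigen := L.bra_eigen
  θ_injective := L.θ_injective
  f := L.bras
  f_eigen := L.bras_eigen
  θs_injective := L.θs_injective

/-- The transposed representation with the roles of the generators exchanged. -/
def dualModuleSwap : AWModule D.swap (Module.Dual ℂ V) where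
  a := L.tr D.genAs
  s := L.tr D.genA
  rel_a := by
    rw [D.swap_ρ, D.swap_ω, D.swap_η, inv_pow, inv_inv, add_comm ((D.q ^ 2)⁻¹)]
    exact L.tr_relAs
  rel_s := by
    rw [D.swap_ρ, D.swap_ω, D.swap_ηs, inv_pow, inv_inv, add_comm ((D.q ^ 2)⁻¹)]
    exact L.tr_relA
  irreducible := fun W h1 h2 => L.dual_irreducible W h2 h1
  e := L.bras
  e_eigen := fun N => by rw [D.swap_θ]; exact L.bras_eigen N
  θ_injective := fun N N' h => L.θs_injective (by simpa only [D.swap_θ] using h)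
  f := L.bra
  f_eigen := fun M => by rw [D.swap_θs]; exact L.bra_eigen M
  θs_injective := fun M M' h => L.θ_injective (by simpa only [D.swap_θs] using h)

/-- The exchange negates the prefactor `q² - q⁻²` and also the bracket, so the signs cancel. -/
theorem dualModuleSwap_w : L.dualModuleSwap.w = L.dualModule.w := by
  have e : D.ω / (D.q⁻¹ - D.q) = -(D.ω / (D.q - D.q⁻¹)) := by rw [← div_neg, neg_sub]
  rw [AWModule.w, AWModule.w, D.swap_ρ, D.swap_ω]
  simp only [dualModule, dualModuleSwap, inv_inv, inv_pow, e]
  module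

/-- Transposition reverses products, so `[A*, A]_q` becomes `q a s - q⁻¹ s a`, the commutator in
`w`. -/
theorem tr_KB (u : ℂ) : L.tr (D.KB u) = (-(D.χ * b (u ^ 2) / (D.q ^ 2 - (D.q ^ 2)⁻¹))) •
    (L.dualModule.w - D.specVar u • (1 : Module.End ℂ (Module.Dual ℂ V))) := by
  have h := D.q_sq_sub_inv_ne_zero
  simp only [Params.KB, qComm, tr_smul, tr_add, tr_sub, tr_mul, tr_one, AWModule.w, dualModule,
    Params.specVar]
  generalize D.q ^ 2 - (D.q ^ 2)⁻¹ = Qs at *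
  generalize D.ω / (D.q - D.q⁻¹) = c
  generalize D.ρ⁻¹ = ρi
  match_scalars <;> field_simp
  ring

/-! ### Dual Bethe states as polynomials in `w`. -/

theorem comp_prod_ofFn {N : ℕ} (g : Fin N → D.AW) (k x : Fin N → ℂ)
    (hg : ∀ i, L.tr (g i) =
      k i • (L.dualModule.w - x i • (1 : Module.End ℂ (Module.Dual ℂ V))))
    (φ : Module.Dual ℂ V) : φ.comp (L.π (List.ofFn g).prod) =
      (∏ i, k i) • aeval L.dualModule.w (AWModule.rootPoly x) φ := by
  induction N generalizing φ with
  | zero =>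
    simp only [List.ofFn_zero, List.prod_nil, map_one, Finset.univ_eq_empty, Finset.prod_empty,
      one_smul, AWModule.rootPoly, Module.End.one_apply]
    rfl
  | succ N ih =>
    have h0 : φ.comp (L.π (g 0)) = k 0 • (L.dualModule.w φ - x 0 • φ) := by
      rw [← tr_apply, hg]; rfl
    rw [List.ofFn_succ, List.prod_cons, map_mul, Module.End.mul_eq_comp, ← LinearMap.comp_assoc,
      ih (fun i => g i.succ) (fun i => k i.succ) (fun i => x i.succ) (fun i => hg i.succ), h0,
      Fin.prod_univ_succ, AWModule.rootPoly, AWModule.rootPoly, Fin.prod_univ_succ, mul_comm (𝕏 - _),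
      map_mul, Module.End.mul_apply]
    simp only [map_sub, aeval_X, aeval_C, LinearMap.sub_apply, Module.algebraMap_end_apply,
      map_smul, smul_smul, mul_comm]

theorem dynC_plus (β u : ℂ) (m : ℤ) :
    D.dynC 1 0 β u m = (D.q⁻¹ * u⁻¹ * (β * D.q ^ (1 - m))⁻¹) • D.KB u := by
  simp [Params.dynC, Params.γ, div_eq_mul_inv]

theorem dynC_minus (β u : ℂ) (m : ℤ) :
    D.dynC (-1) 0 β u m = (D.q * u * (β * D.q ^ (m - 1))⁻¹) • D.KB u := by
  simp [Params.dynC, Params.γ, div_eq_mul_inv]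

theorem dualPsiPlus_eq {β : ℂ} {m₀ : ℤ}
    (hβ : (D.q ^ 2 - (D.q ^ 2)⁻¹) * D.χ⁻¹ * β * D.tbs * D.q ^ (-m₀ + 2) = 1)
    (v : Fin D.d → ℂ) : L.dualPsiPlus β m₀ v =
      (∏ i, -((v i)⁻¹ * b (v i ^ 2) * D.tbs * D.q ^ (2 * (i : ℕ) + 2))) •
        L.dualModule.vec (AWModule.rootPoly fun i => D.specVar (v i)) := by
  have hq := D.q_ne_zero
  have hχ := D.χ_ne_zero
  have hQ := D.q_sq_sub_inv_ne_zero
  refine L.comp_prod_ofFn _ _ _ (fun i => ?_) _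
  rw [dynC_plus, tr_smul, tr_KB, smul_smul]
  congr 1
  have hβ0 : β ≠ 0 := by rintro rfl; simp at hβ
  -- The dynamical argument grows by `2` per factor, so the power of `q` in the denominator `γ`
  -- differs from the one normalized by `β` by `q^{2i+3}`; the prefactor `q⁻¹` of the dynamical
  -- operator leaves `q^{2i+2}`.
  have e : D.q ^ (1 - (m₀ + 2 * ((i : ℤ) + 1))) * D.q ^ (2 * (i : ℕ) + 3)
      = D.q ^ (-m₀ + 2) := by
    rw [← zpow_natCast, ← zpow_add₀ hq]; congr 1; push_cast; ring
  have hne : D.q ^ (1 - (m₀ + 2 * ((i : ℤ) + 1))) ≠ 0 := zpow_ne_zero _ hq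
  rw [← e] at hβ
  have e2 : D.q ^ (2 * (i : ℕ) + 3) = D.q ^ (2 * (i : ℕ) + 2) * D.q := by rw [← pow_succ]
  rw [e2] at hβ
  generalize D.q ^ 2 - (D.q ^ 2)⁻¹ = Qs at *
  generalize D.q ^ (1 - (m₀ + 2 * ((i : ℤ) + 1))) = p at *
  generalize D.q ^ (2 * (i : ℕ) + 2) = p' at *
  field_simp at hβ ⊢
  linear_combination b (v i ^ 2) * (v i)⁻¹ * hβ

theorem dualPsiMinus_eq {β : ℂ} {m₀ : ℤ}
    (hβ : (D.q ^ 2 - (D.q ^ 2)⁻¹) * D.χ⁻¹ * β * D.tc * D.q ^ (m₀ - 2) = -1)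
    (v : Fin D.d → ℂ) : L.dualPsiMinus β m₀ v =
      (∏ i, (v i * b (v i ^ 2) * D.tc * (D.q ^ (2 * (i : ℕ) + 2))⁻¹)) •
        L.dualModuleSwap.vec (AWModule.rootPoly fun i => D.specVar (v i)) := by
  have hq := D.q_ne_zero
  have hχ := D.χ_ne_zero
  have hQ := D.q_sq_sub_inv_ne_zero
  rw [AWModule.vec, dualModuleSwap_w]
  refine L.comp_prod_ofFn _ _ _ (fun i => ?_) _
  rw [dynC_minus, tr_smul, tr_KB, smul_smul]
  congr 1
  have hβ0 : β ≠ 0 := by rintro rfl; simp at hβ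
  have e : D.q ^ (m₀ + 2 * ((i : ℤ) + 1) - 1) = D.q ^ (m₀ - 2) * (D.q ^ (2 * (i : ℕ) + 2) * D.q) := by
    rw [← pow_succ, ← zpow_natCast, ← zpow_add₀ hq]; congr 1; push_cast; ring
  have hne : D.q ^ (m₀ - 2) ≠ 0 := zpow_ne_zero _ hq
  have hne' : D.q ^ (2 * (i : ℕ) + 2) ≠ 0 := pow_ne_zero _ hq
  rw [e]
  generalize D.q ^ 2 - (D.q ^ 2)⁻¹ = Qs at *
  generalize D.q ^ (m₀ - 2) = p at *
  generalize D.q ^ (2 * (i : ℕ) + 2) = p' at *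
  field_simp at hβ ⊢
  linear_combination -b (v i ^ 2) * v i * hβ

/-! ### Overlaps and the normalization constants. -/

theorem bras_kets_eq_zero {N N' : Fin (D.d + 1)} (h : N ≠ N') : L.bras N (L.kets N') = 0 :=
  dual_apply_eq_zero L.θs_injective L.kets_eigen L.bras_eigen h

theorem bra_ket_eq_zero {N N' : Fin (D.d + 1)} (h : N ≠ N') : L.bra N (L.ket N') = 0 :=
  dual_apply_eq_zero L.θ_injective L.ket_eigen L.bra_eigen h

theorem ξs_ne_zero (N : Fin (D.d + 1)) : L.ξs N ≠ 0 :=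
  dual_apply_self_ne_zero (fun _ _ => L.bras_kets_eq_zero) N

theorem ξ_ne_zero (N : Fin (D.d + 1)) : L.ξ N ≠ 0 :=
  dual_apply_self_ne_zero (fun _ _ => L.bra_ket_eq_zero) N

/-- Evaluate `⟨θ_M|θ*_N⟩` twice: expanding the bra gives `ξ*_N`, expanding the ket gives `P_{MN}
ξ_M`. -/
theorem bras_repr_bra (M N : Fin (D.d + 1)) :
    L.bras.repr (L.bra M) N = L.P M N * (L.ξ M / L.ξs N) := by
  have h1 : L.bra M (L.kets N) = L.bras.repr (L.bra M) N * L.ξs N := by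
    conv_lhs => rw [← L.bras.sum_repr (L.bra M), LinearMap.sum_apply]
    rw [Finset.sum_eq_single N]
    · rfl
    · intro j _ hj
      rw [LinearMap.smul_apply, L.bras_kets_eq_zero hj, smul_zero]
    · simp
  have h2 : L.bra M (L.kets N) = L.P M N * L.ξ M := by
    conv_lhs => rw [← L.ket.sum_repr (L.kets N), map_sum]
    rw [Finset.sum_eq_single M]
    · rw [map_smul]; rfl
    · intro j _ hj
      rw [map_smul, L.bra_ket_eq_zero hj.symm, smul_zero]
    · simp
  rw [← mul_div_assoc, eq_div_iff (L.ξs_ne_zero N), ← h1, h2]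

theorem P_inv : L.P⁻¹ = Matrix.of fun M N => L.kets.repr (L.ket N) M := by
  have h : L.P = L.ket.toMatrix L.kets := rfl
  rw [h]
  exact Matrix.inv_eq_left_inv (L.kets.toMatrix_mul_toMatrix_flip L.ket)

theorem bra_repr_bras (M N : Fin (D.d + 1)) :
    L.bra.repr (L.bras M) N = L.P⁻¹ M N * (L.ξs M / L.ξ N) := by
  have h1 : L.bras M (L.ket N) = L.bra.repr (L.bras M) N * L.ξ N := by
    conv_lhs => rw [← L.bra.sum_repr (L.bras M), LinearMap.sum_apply]
    rw [Finset.sum_eq_single N]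
    · rfl
    · intro j _ hj
      rw [LinearMap.smul_apply, L.bra_ket_eq_zero hj, smul_zero]
    · simp
  have h2 : L.bras M (L.ket N) = L.P⁻¹ M N * L.ξs M := by
    conv_lhs => rw [← L.kets.sum_repr (L.ket N), map_sum]
    rw [Finset.sum_eq_single M]
    · rw [map_smul, P_inv]; rfl
    · intro j _ hj
      rw [map_smul, L.bras_kets_eq_zero hj.symm, smul_zero]
    · simp
  rw [← mul_div_assoc, eq_div_iff (L.ξ_ne_zero N), ← h1, h2]

theorem bra_eq_smul_dualPsiPlus {β : ℂ} {m₀ : ℤ}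
    (hβ : (D.q ^ 2 - (D.q ^ 2)⁻¹) * D.χ⁻¹ * β * D.tbs * D.q ^ (-m₀ + 2) = 1)
    {M : Fin (D.d + 1)} {v : Fin D.d → ℂ} (hv : D.IsDualRootsPlus M v) :
    L.bra M = L.NtildeInhom M v • L.dualPsiPlus β m₀ v := by
  obtain ⟨hadm, hE, hθ⟩ := hv
  have hq := D.q_ne_zero
  have hb := D.tbs_ne_zero
  have h := L.dualModule.e_eq_smul_vec hadm.ne_zero (fun i => (hadm.1 i).2.2) hadm.injective
    (D.isBethe_plus hadm hE) hθ
  have hrepr : L.dualModule.f.repr (L.dualModule.e M) (Fin.last D.d) = L.P M (Fin.last D.d) *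
    (L.ξ M / L.ξs (Fin.last D.d)) := L.bras_repr_bra M (Fin.last D.d)
  rw [hrepr] at h
  rw [L.dualPsiPlus_eq hβ, smul_smul]
  refine h.trans ?_
  congr 1
  -- Factor by factor, the parameter-dependent terms and the signs cancel; the `q` in `Nstilde`
  -- accounts for `q^{2i+2}` in the state against `q^{2i+1}` in `kap`.
  have e : L.Nstilde v * ∏ i, -((v i)⁻¹ * b (v i ^ 2) * D.tbs * D.q ^ (2 * (i : ℕ) + 2)) =
      (∏ k, L.dualModule.kap k)⁻¹ := by
    rw [Nstilde, ← Finset.prod_mul_distrib, ← Finset.prod_inv_distrib]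
    refine Finset.prod_congr rfl fun i _ => ?_
    have h1 : L.dualModule.kap i =
      D.tbs⁻¹ * (D.q ^ (2 * (i : ℕ) + 1))⁻¹ * L.Atilde i.castSucc i.succ := rfl
    have h2 := hadm.ne_zero i
    have h3 := hadm.b_sq_ne_zero i
    have h4 : L.Atilde i.castSucc i.succ ≠ 0 := L.dualModule.entry_succ_ne_zero i
    rw [h1, pow_succ D.q (2 * (i : ℕ) + 1)]
    have h5 : D.q ^ (2 * (i : ℕ) + 1) ≠ 0 := pow_ne_zero _ hq
    generalize D.q ^ (2 * (i : ℕ) + 1) = p at *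
    field_simp
  rw [← e, NtildeInhom]
  ring

theorem bras_eq_smul_dualPsiMinus {β : ℂ} {m₀ : ℤ}
    (hβ : (D.q ^ 2 - (D.q ^ 2)⁻¹) * D.χ⁻¹ * β * D.tc * D.q ^ (m₀ - 2) = -1)
    {N : Fin (D.d + 1)} {v : Fin D.d → ℂ} (hv : D.IsDualRootsMinus N v) :
    L.bras N = L.NstildeInhom N v • L.dualPsiMinus β m₀ v := by
  obtain ⟨hadm, hE, hθ⟩ := hv
  have hq := D.q_ne_zero
  have hb := D.tc_ne_zero
  have h := L.dualModuleSwap.e_eq_smul_vec (y := fun i => (v i)⁻¹) (M := N)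
    (fun i => inv_ne_zero (hadm.ne_zero i))
    (fun i => by
      have e1 : b (D.q⁻¹ * (v i)⁻¹ ^ 2) = -b (D.q * v i ^ 2) := by
        rw [← b_inv, mul_inv, inv_pow]
      rw [e1]
      exact neg_ne_zero.2 (hadm.1 i).2.2)
    (by simpa only [D.swap_specVar] using hadm.injective)
    (D.isBethe_minus hadm hE) (by rw [D.swap_θ, D.swap_dualEigPlus, hθ])
  have hrepr : L.dualModuleSwap.f.repr (L.dualModuleSwap.e N) (Fin.last D.swap.d) =
    L.P⁻¹ N (Fin.last D.d) * (L.ξs N / L.ξ (Fin.last D.d)) := L.bra_repr_bras N (Fin.last D.d)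
  rw [hrepr] at h
  simp only [D.swap_specVar] at h
  rw [L.dualPsiMinus_eq hβ, smul_smul]
  refine h.trans ?_
  congr 1
  have e : L.Ntilde v * ∏ i, (v i * b (v i ^ 2) * D.tc * (D.q ^ (2 * (i : ℕ) + 2))⁻¹) =
      (∏ k, L.dualModuleSwap.kap k)⁻¹ := by
    rw [Ntilde, ← Finset.prod_mul_distrib, ← Finset.prod_inv_distrib]
    refine Finset.prod_congr rfl fun i _ => ?_
    have h1 : L.dualModuleSwap.kap i =
      D.tc⁻¹ * (D.q⁻¹ ^ (2 * (i : ℕ) + 1))⁻¹ * L.Astilde i.castSucc i.succ := rfl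
    have h2 := hadm.ne_zero i
    have h3 := hadm.b_sq_ne_zero i
    have h4 : L.Astilde i.castSucc i.succ ≠ 0 := L.dualModuleSwap.entry_succ_ne_zero i
    rw [h1, pow_succ D.q (2 * (i : ℕ) + 1), inv_pow, inv_inv]
    have h5 : D.q ^ (2 * (i : ℕ) + 1) ≠ 0 := pow_ne_zero _ hq
    generalize D.q ^ (2 * (i : ℕ) + 1) = p at *
    field_simp
  rw [← e, NstildeInhom]
  ring

end LeonardRep

end QRacahBethe

end

theorem mainTheorem6 (D : QRacahBethe.Params) {V : Type*} [AddCommGroup V] [Module ℂ V]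
    (L : QRacahBethe.LeonardRep D V) (m₀ : ℤ) (βplus βminus : ℂ)
    (hplus : (D.q ^ 2 - (D.q ^ 2)⁻¹) * D.χ⁻¹ * βplus * D.tbs * D.q ^ (-m₀ + 2) = 1)
    (hminus : (D.q ^ 2 - (D.q ^ 2)⁻¹) * D.χ⁻¹ * βminus * D.tc * D.q ^ (m₀ - 2) = -1) :
    (∀ (M : Fin (D.d + 1)) (v : Fin D.d → ℂ), D.IsDualRootsPlus M v →
      L.bra M = L.NtildeInhom M v • L.dualPsiPlus βplus m₀ v) ∧
    (∀ (N : Fin (D.d + 1)) (y : Fin D.d → ℂ), D.IsDualRootsMinus N y →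
      L.bras N = L.NstildeInhom N y • L.dualPsiMinus βminus m₀ y) ∧
    (D.DualRootsExist →
      (∀ M : Fin (D.d + 1), ∃ v : Fin D.d → ℂ, D.IsDualRootsPlus M v ∧
        L.bra M = L.NtildeInhom M v • L.dualPsiPlus βplus m₀ v) ∧
      (∀ N : Fin (D.d + 1), ∃ y : Fin D.d → ℂ, D.IsDualRootsMinus N y ∧
        L.bras N = L.NstildeInhom N y • L.dualPsiMinus βminus m₀ y)) := by
  refine ⟨fun M v hv => L.bra_eq_smul_dualPsiPlus hplus hv,
    fun N y hy => L.bras_eq_smul_dualPsiMinus hminus hy, fun hex => ⟨fun M => ?_, fun N => ?_⟩⟩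
  · obtain ⟨v, hv⟩ := hex.1 M
    exact ⟨v, hv, L.bra_eq_smul_dualPsiPlus hplus hv⟩
  · obtain ⟨y, hy⟩ := hex.2 N
    exact ⟨y, hy, L.bras_eq_smul_dualPsiMinus hminus hy⟩
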